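/- **Setting.** Let $\mathcal W=\{w_1,\dots,w_L\}$ be the internal signals, $\mathcal C\subseteq\mathcal W$ the measured ones ($c=|\mathcal C|$, $\mathcal Z=\mathcal W\setminus\mathcal C$), $r_1,\dots,r_K$ excitation signals and $\tilde e$ a $c$-dimensional white noise. Consider a parameterized set $\mathcal M=\{M(\theta):\theta\in\Theta\}$, $\Theta\subseteq\mathbb R^n$, of network models $$w=G(q,\theta)w+Rr+\begin{bmatrix}\tilde H(q,\theta)\\0\end{bmatrix}\tilde e,\qquad w_{\mathcal C}=Cw,\qquad \operatorname{cov}\tilde e=\tilde\Lambda(\theta),$$ where $C$ selects the measured signals (listed first), $R$ consists of $K$ distinct columns of the identity matrix, and every entry of $G$ and $\tilde H$ is a real rational function of $q$ of bounded degree whose numerator and denominator coefficients are real-analytic functions of $\theta$ on a connected open set containing $\Theta$ (e.g. the coefficients are the parameters), with nonzero denominator for $\theta\in\Theta$. "Stable" means that all poles lie in $|z|<1$; a square invertible transfer matrix is "minimum phase" if its inverse has no poles in $|z|>1$. For every $\theta\in\Theta$: $G$ is proper, stable and has zero diagonal; $T=(I-G)^{-1}$ is stable; all principal minors of $I-G^\infty$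 are nonzero, where $G^\infty=\lim_{z\to\infty}G(z)$; $\tilde H$ is proper, stable, minimum phase and monic ($\tilde H(\infty)=I$); $\tilde\Lambda$ is real and positive semidefinite. Put $X=\begin{bmatrix}R&\begin{bmatrix}\tilde H\\0\end{bmatrix}\end{bmatrix}$ and let $\Phi(\omega)$ be the power spectrum of $T\begin{bmatrix}\tilde H\\0\end{bmatrix}\tilde e$. An entry of $G$ or $X$ is *known* if it does not depend on $\theta\in\Theta$, and *unknown* otherwise. Assume moreover: * for every $\theta\in\Theta$, $C\Phi(\omega)C^\top$ has full rank for almost all $\omega$; * for every $\theta\in\Theta$, the noise-to-measurement map $CT\begin{bmatrix}\tilde H\\0\end{bmatrix}$ is minimum phase (so that it is a stable, minimum-phase spectral factor of $C\Phi C^\top$); * the entries of $G$ and $\tilde H$ are parameterized independently, i.e. no component of $\theta$ occurs in two different entries; * either $G(q,\theta)$ is strictly proper for all $\theta\in\Theta$, or $\tilde\Lambda(\theta)$ is diagonal for all $\theta\in\Theta$ and there is a permutation matrix $P$ such that $PG^\infty(\theta)P^\top$ is lower triangular for all $\theta\in\Theta$; * every submatrix of $[\,G-I\;\;X\,]$ that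 does not depend on $\theta$ has rank equal to its structural rank, the largest rank of a matrix with the same nonzero pattern. **Graph.** The vertices are the internal signals and the external signals $\mathcal X=\{r_1,\dots,r_K,\tilde e_1,\dots,\tilde e_c\}$; there is an edge into $w_j$ from each vertex whose entry in row $j$ of $[G\;X]$ is not fixed to zero. A single vertex is a path, paths do not repeat vertices, and $b_{\mathcal V_1\to\mathcal V_2}$ is the maximum number of vertex disjoint directed paths from $\mathcal V_1$ to $\mathcal V_2$. $\mathcal X_j$ is the set of external signals with no unknown edge to $w_j$; $\mathcal N_j^-$ is the set of internal in-neighbors of $w_j$ except the measured ones with a known edge to $w_j$. **Proposition.** Let $w_i,w_j\in\mathcal C$ and suppose that for some $\bar{\mathcal X}\subseteq\mathcal X_j$ and $\bar{\mathcal C}\subseteq\mathcal C\setminus\{w_i\}$ $$b_{\bar{\mathcal X}\to\mathcal N_j^-\cup\bar{\mathcal C}}=b_{\bar{\mathcal X}\to(\mathcal N_j^-\setminus\{w_i\})\cup\bar{\mathcal C}}+1,\qquad b_{\bar{\mathcal X}\to(\mathcal N_j^-\setminus\{w_i\})\cup\bar{\mathcal C}}=b_{\bar{\mathcal X}\to\bar{\mathcal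 C}}.$$ Then $G_{ji}$ is generically identifiable in $\mathcal M$ from $(w_{\mathcal C},r)$: for almost all $\theta_0\in\Theta$ (all outside a Lebesgue null set) and all $\theta_1\in\Theta$, if $CT(q,\theta_0)R=CT(q,\theta_1)R$ and $C\Phi(\omega,\theta_0)C^\top=C\Phi(\omega,\theta_1)C^\top$ for all $\omega$, then $G_{ji}(q,\theta_0)=G_{ji}(q,\theta_1)$. -/

import Mathlib

open scoped Matrix

noncomputable section

namespace DynNet

/-! ### Rational transfer functions

A transfer function is an element of `RatFunc ℝ`, the indeterminate being the shift `q`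
(evaluated at a complex number `z`). -/

/-- `g` has a finite limit at infinity. -/
def IsProper (g : RatFunc ℝ) : Prop := g.num.degree ≤ g.denom.degree

/-- `g` tends to `0` at infinity. -/
def IsStrictlyProper (g : RatFunc ℝ) : Prop := g.num.degree < g.denom.degree

/-- All poles lie strictly inside the unit circle. -/
def IsStable (g : RatFunc ℝ) : Prop :=
  ∀ z : ℂ, 1 ≤ ‖z‖ → Polynomial.aeval z g.denom ≠ 0

/-- The value `lim_{z → ∞} g(z)` of a proper rational function (the denominator is monic). -/
def valueAtInfty (g : RatFunc ℝ) : ℝ := g.num.coeff g.denom.natDegree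

/-- `valueAtInfty` is the limit at infinity. -/
theorem tendsto_valueAtInfty {g : RatFunc ℝ} (hg : IsProper g) :
    Filter.Tendsto (fun x : ℝ => g.eval (RingHom.id ℝ) x) Filter.atTop
      (nhds (valueAtInfty g)) := by
  have hm := RatFunc.monic_denom g
  have hfun : (fun x : ℝ => g.eval (RingHom.id ℝ) x) =
      fun x => g.num.eval x / g.denom.eval x := by
    funext x
    simp [RatFunc.eval, Polynomial.eval₂_id]
  rw [hfun]
  rcases lt_or_eq_of_le hg with h | h
  · have h0 : valueAtInfty g = 0 :=
      Polynomial.coeff_eq_zero_of_degree_lt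
        (by rwa [← Polynomial.degree_eq_natDegree hm.ne_zero])
    rw [h0]
    exact Polynomial.div_tendsto_atTop_zero_of_degree_lt _ _ h
  · have h1 := Polynomial.div_tendsto_atTop_leadingCoeff_div_of_degree_eq _ _ h
    rw [hm.leadingCoeff, div_one] at h1
    have h2 : valueAtInfty g = g.num.leadingCoeff := by
      rw [valueAtInfty, Polynomial.leadingCoeff, Polynomial.natDegree_eq_of_degree_eq h]
    rwa [h2]

/-- Value of `g` at a complex number (meaningful away from the poles of `g`). -/
def evalAt (z : ℂ) (g : RatFunc ℝ) : ℂ := g.eval (algebraMap ℝ ℂ) z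

/-- The square transfer matrix `A` is invertible and its inverse has no pole outside the closed
unit disc. Zeros of `A` on the unit circle are allowed, as for spectral factors of spectra that
have full rank at almost all frequencies only. -/
def IsMinimumPhase {ι : Type*} [Fintype ι] [DecidableEq ι]
    (A : Matrix ι ι (RatFunc ℝ)) : Prop :=
  A.det ≠ 0 ∧ ∀ i j, ∀ z : ℂ, 1 < ‖z‖ → Polynomial.aeval z (A⁻¹ i j).denom ≠ 0

/-- The largest rank of a matrix with the same nonzero pattern as `A`. -/
def structuralRank {m l F : Type*} [Fintype m] [Fintype l] [Field F] (A : Matrix m l F) : ℕ :=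
  sSup {r : ℕ | ∃ B : Matrix m l F, (∀ i j, B i j = 0 ↔ A i j = 0) ∧ B.rank = r}

/-! ### Vertex disjoint paths in a directed graph -/

/-- `l` lists the vertices of a directed path from a vertex of `A` to a vertex of `B`, without
repetition. A single vertex is a path from itself to itself. -/
def IsPath {α : Type*} (adj : α → α → Prop) (A B : Set α) (l : List α) : Prop :=
  l.IsChain adj ∧ l.Nodup ∧ (∃ a ∈ A, l.head? = some a) ∧ (∃ b ∈ B, l.getLast? = some b)

/-- `b_{A → B}`: the maximum number of vertex disjoint paths from `A` to `B`
(on a finite vertex set). -/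
def maxDisjointPaths {α : Type*} (adj : α → α → Prop) (A B : Set α) : ℕ :=
  sSup {k : ℕ | ∃ p : Fin k → List α, (∀ s, IsPath adj A B (p s)) ∧
    ∀ s t, s ≠ t → (p s).Disjoint (p t)}

/-! ### Parameterized network model sets -/

/-- A rational function of `q` whose numerator and denominator coefficients are real-analytic
functions of the parameter vector `θ` on `U` (for example the coefficients themselves may be the
parameters). -/
structure RationalFamily (n : ℕ) (U : Set (Fin n → ℝ)) where
  num : (Fin n → ℝ) → Polynomial ℝ
  den : (Fin n → ℝ) → Polynomial ℝ
  degBound : ℕ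
  num_natDegree_le : ∀ θ ∈ U, (num θ).natDegree ≤ degBound
  den_natDegree_le : ∀ θ ∈ U, (den θ).natDegree ≤ degBound
  num_analytic : ∀ k, AnalyticOnNhd ℝ (fun θ => (num θ).coeff k) U
  den_analytic : ∀ k, AnalyticOnNhd ℝ (fun θ => (den θ).coeff k) U

namespace RationalFamily

variable {n : ℕ} {U : Set (Fin n → ℝ)}

/-- The transfer function at the parameter value `θ`. -/
def value (f : RationalFamily n U) (θ : Fin n → ℝ) : RatFunc ℝ :=
  algebraMap (Polynomial ℝ) (RatFunc ℝ) (f.num θ) /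
    algebraMap (Polynomial ℝ) (RatFunc ℝ) (f.den θ)

/-- Only the parameters `θ k` with `k ∈ S` occur in the family. -/
def DependsOnlyOn (f : RationalFamily n U) (S : Set (Fin n)) : Prop :=
  ∀ θ ∈ U, ∀ θ' ∈ U, (∀ k ∈ S, θ k = θ' k) → f.num θ = f.num θ' ∧ f.den θ = f.den θ'

end RationalFamily

/-- The data of a parameterized set of network models
`w = G w + R r + [H; 0] e`, `w_C = C w`, `cov e = Λ`.
Internal signals are indexed by `V`, excitation signals by `K`, and the noise signals by the
measured internal signals. -/
structure ParamNetwork (V K : Type*) (n : ℕ) where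
  /-- a domain on which the parameterization formulas are defined -/
  domain : Set (Fin n → ℝ)
  /-- the parameter set `Θ` -/
  Θ : Set (Fin n → ℝ)
  /-- the measured internal signals -/
  meas : Finset V
  /-- `exc p` is the internal signal that is excited by `r_p` -/
  exc : K → V
  Gfam : V → V → RationalFamily n domain
  Hfam : meas → meas → RationalFamily n domain
  /-- the noise covariance matrix -/
  Λ : (Fin n → ℝ) → Matrix meas meas ℝ

namespace ParamNetwork

variable {V K : Type*} [Fintype V] [DecidableEq V] [Fintype K] {n : ℕ}
  (M : ParamNetwork V K n)

/-- External signals: the excitation signals `r` and the noise signals `e`. -/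
abbrev Ext : Type _ := K ⊕ M.meas

/-- Vertices of the graph of the model set. -/
abbrev Vertex : Type _ := V ⊕ M.Ext

/-- `G(q, θ)`; the entry `G j i` is the module from `w_i` to `w_j`. -/
def G (θ : Fin n → ℝ) : Matrix V V (RatFunc ℝ) := Matrix.of fun j i => (M.Gfam j i).value θ

/-- `G^∞(θ) = lim_{z → ∞} G(z, θ)`. -/
def Ginf (θ : Fin n → ℝ) : Matrix V V ℝ := (M.G θ).map valueAtInfty

/-- The square block `H(q, θ)` of the noise model. -/
def H (θ : Fin n → ℝ) : Matrix M.meas M.meas (RatFunc ℝ) :=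
  Matrix.of fun j k => (M.Hfam j k).value θ

/-- The full noise model `[H; 0]`: unmeasured internal signals are noise-free. -/
def Hfull (θ : Fin n → ℝ) : Matrix V M.meas (RatFunc ℝ) :=
  Matrix.of fun j k => if h : j ∈ M.meas then M.H θ ⟨j, h⟩ k else 0

/-- The binary matrix `R`. -/
def R : Matrix V K (RatFunc ℝ) := Matrix.of fun j p => if M.exc p = j then 1 else 0

/-- `X = [R  [H; 0]]`. -/
def X (θ : Fin n → ℝ) : Matrix V M.Ext (RatFunc ℝ) := Matrix.fromCols M.R (M.Hfull θ)

/-- `T = (I - G)⁻¹`. -/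
def T (θ : Fin n → ℝ) : Matrix V V (RatFunc ℝ) := (1 - M.G θ)⁻¹

/-- Pre-multiplication by the selection matrix `C`: keep the rows of the measured signals. -/
def selC {l F : Type*} (A : Matrix V l F) : Matrix M.meas l F :=
  A.submatrix (fun c : M.meas => (c : V)) id

/-- `C T R`, the mapping from `r` to the measured signals. -/
def CTR (θ : Fin n → ℝ) : Matrix M.meas K (RatFunc ℝ) := M.selC (M.T θ * M.R)

/-- `C T [H; 0]`, the mapping from the noise to the measured signals. -/
def CTH (θ : Fin n → ℝ) : Matrix M.meas M.meas (RatFunc ℝ) := M.selC (M.T θ * M.Hfull θ)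

/-- The frequency response `(T [H; 0])(e^{iω})`. -/
def noiseResponse (θ : Fin n → ℝ) (ω : ℝ) : Matrix V M.meas ℂ :=
  (M.T θ * M.Hfull θ).map (evalAt (Complex.exp (Complex.I * ω)))

/-- The power spectrum `Φ(ω)` of the noise contribution to `w`. -/
def Phi (θ : Fin n → ℝ) (ω : ℝ) : Matrix V V ℂ :=
  M.noiseResponse θ ω * (M.Λ θ).map (algebraMap ℝ ℂ) * (M.noiseResponse θ ω)ᴴ

/-- `C Φ(ω) Cᵀ`. -/
def CPhiC (θ : Fin n → ℝ) (ω : ℝ) : Matrix M.meas M.meas ℂ :=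
  (M.Phi θ ω).submatrix (fun c : M.meas => (c : V)) (fun c : M.meas => (c : V))

/-- The standing requirements on a network model set with the noise structure `[H; 0]`. -/
structure IsModelSet : Prop where
  domain_isOpen : IsOpen M.domain
  domain_isPreconnected : IsPreconnected M.domain
  subset_domain : M.Θ ⊆ M.domain
  G_den_ne_zero : ∀ θ ∈ M.Θ, ∀ j i, (M.Gfam j i).den θ ≠ 0
  H_den_ne_zero : ∀ θ ∈ M.Θ, ∀ j k, (M.Hfam j k).den θ ≠ 0
  /-- `R` consists of distinct columns of an identity matrix -/
  exc_injective : Function.Injective M.exc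
  G_hollow : ∀ θ ∈ M.Θ, ∀ i, M.G θ i i = 0
  G_proper : ∀ θ ∈ M.Θ, ∀ j i, IsProper (M.G θ j i)
  G_stable : ∀ θ ∈ M.Θ, ∀ j i, IsStable (M.G θ j i)
  T_stable : ∀ θ ∈ M.Θ, ∀ j i, IsStable (M.T θ j i)
  /-- well-posedness: all principal minors of `I - G^∞` are nonzero -/
  wellPosed : ∀ θ ∈ M.Θ, ∀ S : Finset V,
    ((1 - M.Ginf θ).submatrix (fun s : S => (s : V)) (fun s : S => (s : V))).det ≠ 0
  H_proper : ∀ θ ∈ M.Θ, ∀ j k, IsProper (M.H θ j k)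
  H_stable : ∀ θ ∈ M.Θ, ∀ j k, IsStable (M.H θ j k)
  H_monic : ∀ θ ∈ M.Θ, (M.H θ).map valueAtInfty = 1
  H_minimumPhase : ∀ θ ∈ M.Θ, IsMinimumPhase (M.H θ)
  Λ_posSemidef : ∀ θ ∈ M.Θ, (M.Λ θ).PosSemidef

/-- `C Φ Cᵀ` has full rank at almost all frequencies. -/
def FullRankSpectrum : Prop :=
  ∀ θ ∈ M.Θ, ∀ᵐ ω : ℝ, (M.CPhiC θ ω).rank = M.meas.card

/-- No parameter occurs in two different entries of `G` and `H`. -/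
def IndependentlyParameterized : Prop :=
  ∃ S : (V × V) ⊕ (M.meas × M.meas) → Set (Fin n),
    (∀ a b, a ≠ b → Disjoint (S a) (S b)) ∧
    (∀ j i, (M.Gfam j i).DependsOnlyOn (S (Sum.inl (j, i)))) ∧
    (∀ j k, (M.Hfam j k).DependsOnlyOn (S (Sum.inr (j, k))))

/-- Either `G` is strictly proper, or `Λ` is diagonal and there are no algebraic loops: after a
simultaneous permutation of rows and columns `G^∞(θ)` is lower triangular. -/
def FeedthroughCondition : Prop :=
  (∀ θ ∈ M.Θ, ∀ j i, IsStrictlyProper (M.G θ j i)) ∨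
  ((∀ θ ∈ M.Θ, (M.Λ θ).IsDiag) ∧
    ∃ σ : V ≃ Fin (Fintype.card V), ∀ θ ∈ M.Θ, ∀ j i, σ j < σ i → M.Ginf θ j i = 0)

/-- `[G  X]`; the entry `GX j u` is the transfer function on the edge from `u` to `w_j`. -/
def GX (θ : Fin n → ℝ) : Matrix V M.Vertex (RatFunc ℝ) := Matrix.fromCols (M.G θ) (M.X θ)

/-- The entry on the edge `u → w_j` is known (fixed): it does not depend on `θ`. -/
def IsKnown (u : M.Vertex) (j : V) : Prop :=
  ∀ θ ∈ M.Θ, ∀ θ' ∈ M.Θ, M.GX θ j u = M.GX θ' j u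

/-- The entry on the edge `u → w_j` is fixed to zero. -/
def IsFixedZero (u : M.Vertex) (j : V) : Prop := ∀ θ ∈ M.Θ, M.GX θ j u = 0

/-- The graph of the model set: an edge into `w_j` for each entry that is not fixed to zero. -/
def Edge (u v : M.Vertex) : Prop := ∃ j : V, v = Sum.inl j ∧ ¬ M.IsFixedZero u j

/-- `b_{A → B}` in the graph of the model set. -/
def b (A B : Set M.Vertex) : ℕ := maxDisjointPaths M.Edge A B

/-- Every submatrix of `[G - I  X]` that does not depend on `θ` has rank equal to its structural
rank. -/
def FixedEntriesRegular : Prop :=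
  ∀ (I : Finset V) (J : Finset M.Vertex),
    let sub : (Fin n → ℝ) → Matrix I J (RatFunc ℝ) := fun θ =>
      (Matrix.fromCols (M.G θ - 1) (M.X θ)).submatrix
        (fun s : I => (s : V)) (fun s : J => (s : M.Vertex))
    (∀ θ ∈ M.Θ, ∀ θ' ∈ M.Θ, sub θ = sub θ') →
      ∀ θ ∈ M.Θ, (sub θ).rank = structuralRank (sub θ)

/-- `𝒳_j`: the external signals that have no unknown edge to `w_j`. -/
def extNoUnknown (j : V) : Set M.Ext := {x | M.IsKnown (Sum.inr x) j}

/-- `𝒩_j⁻`: the internal in-neighbors of `w_j`, except the measured ones that have a known edge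
to `w_j`. -/
def inNbr (j : V) : Set V :=
  {v | ¬ M.IsFixedZero (Sum.inl v) j ∧ ¬ (v ∈ M.meas ∧ M.IsKnown (Sum.inl v) j)}

/-- Generic identifiability of `G_ji` in the model set from `(w_C, r)`. -/
def GenericallyIdentifiable (j i : V) : Prop :=
  ∀ᵐ θ₀ : Fin n → ℝ, θ₀ ∈ M.Θ → ∀ θ₁ ∈ M.Θ,
    M.CTR θ₀ = M.CTR θ₁ → (∀ ω : ℝ, M.CPhiC θ₀ ω = M.CPhiC θ₁ ω) → M.G θ₀ j i = M.G θ₁ j i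

end ParamNetwork

end DynNet

end

/-! Write `TX = (I - G)⁻¹ X` for the map from external to internal signals. Two models with the same
data have the same measured rows of `TX`. For the excitation columns this is given. For the noise
columns it follows from the spectrum (`CTH_eq_of_CPhiC_eq`): the two spectral factors differ by a
constant right factor (`spectralFactor_unique`), and the feedthrough condition forces that factor to
be the identity.

Row `j` of `(I - G) TX = X`, restricted to the columns in `Xbar`, then shows that the sum of `G_jk`
times row `k` of `TX` over `k ∈ inNbr j` is the same for both models. Let `S` be the span of the
rows in `Cbar`, which are measured and hence common to both. If the rows of `inNbr j \ {i}` lie in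
`S` for both models and row `i` does not, reduction modulo `S` gives equality of `G_ji`
(`G_eq_of_rowSpan`).

These span conditions are rank conditions, and ranks are compared with numbers of disjoint paths.
The rank is at most `b` for every `θ ∈ Θ` (`finrank_rowSpan_le_b`) and at least `b` for almost every
one (`ae_b_le_finrank_rowSpan`). The asymmetry is harmless: `θ₁` is arbitrary, but it inherits the
rank of the rows in `Cbar` from the generic `θ₀`.

For both bounds, a minor of `TX` is seen as the Schur complement in the matrix `[G - I X; E 0]`. A
nonzero Leibniz term of its determinant is a permutation whose cycles through the auxiliary vertices
are disjoint paths. Conversely, disjoint paths give a permutation along entries that are not fixed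
to zero, and `exists_det_ne_zero_of_matching` chooses values of the entries with nonzero
determinant; regularity of the fixed entries covers the blocks that leave no choice. Independent
parameterization realizes the chosen values by one parameter vector near a point of `Θ`, and
analyticity turns one nonzero value into almost all. -/

open scoped Matrix

noncomputable section

namespace DynNet

/-! ### Determinants of matrices with independently chosen entries -/

section MixedMatrix

universe u

variable {ι κ F : Type*} [Field F]

/-- Two matrices that differ in one diagonal entry only. -/
theorem det_sub_det_of_eq_off {s : Type*} [Fintype s] [DecidableEq s] (M N : Matrix s s F) (s₀ : s)
    (h : ∀ a b, (a ≠ s₀ ∨ b ≠ s₀) → M a b = N a b) :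
    M.det - N.det = (M s₀ s₀ - N s₀ s₀) *
      (N.submatrix (Subtype.val : {t // t ≠ s₀} → s) Subtype.val).det := by
  have hM : M = N.updateRow s₀ (N s₀ + (M s₀ s₀ - N s₀ s₀) • Pi.single s₀ 1) := by
    ext a b
    by_cases ha : a = s₀
    · subst ha
      by_cases hb : b = a
      · subst hb; simp
      · simp [hb, h a b (Or.inr hb)]
    · simp [Matrix.updateRow_ne ha, h a b (Or.inl ha)]
  have hminor : (N.updateRow s₀ (Pi.single s₀ 1)).det =
      (N.submatrix (Subtype.val : {t // t ≠ s₀} → s) Subtype.val).det := by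
    rw [Matrix.twoBlockTriangular_det _ (fun t => t ≠ s₀)]
    · have h1 : (Matrix.toSquareBlockProp (N.updateRow s₀ (Pi.single s₀ 1))
          fun i => ¬ (i ≠ s₀)) = 1 := by
        ext ⟨a, ha⟩ ⟨b, hb⟩
        simp only [ne_eq, not_not] at ha hb
        subst ha; subst hb
        simp [Matrix.toSquareBlockProp]
      rw [h1, Matrix.det_one, mul_one]
      congr 1
      ext ⟨a, ha⟩ ⟨b, hb⟩
      simp [Matrix.toSquareBlockProp, Matrix.updateRow_ne ha]
    · intro i hi j hj
      simp only [ne_eq, not_not] at hi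
      subst hi
      simp [hj]
  conv_lhs => rw [hM]
  rw [Matrix.det_updateRow_add, Matrix.updateRow_eq_self, Matrix.det_updateRow_smul, hminor]
  ring

/-- A matrix whose entries are chosen independently from value sets `val a b` can be chosen
nonsingular if its nonzero pattern has a perfect matching and every block of single-valued
entries with a nonzero diagonal is nonsingular. -/
theorem exists_det_ne_zero_of_matching (val : ι → κ → Set F) (hne : ∀ a b, (val a b).Nonempty)
    (hreg : ∀ (s : Type u) [Fintype s] [DecidableEq s] (r : s → ι) (c : s → κ),
      r.Injective → c.Injective → (∀ t, ∃ x ∈ val (r t) (c t), x ≠ 0) →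
      (∀ t t', (val (r t) (c t')).Subsingleton) →
      ∀ B : Matrix ι κ F, (∀ a b, B a b ∈ val a b) → (B.submatrix r c).det ≠ 0)
    (s : Type u) [Fintype s] [DecidableEq s] (r : s → ι) (c : s → κ)
    (hr : r.Injective) (hc : c.Injective) (hnz : ∀ t, ∃ x ∈ val (r t) (c t), x ≠ 0) :
    ∃ B : Matrix ι κ F, (∀ a b, B a b ∈ val a b) ∧ (B.submatrix r c).det ≠ 0 := by
  classical
  induction hN : Fintype.card s using Nat.strong_induction_on generalizing s with
  | _ N ih =>
  -- Some matching uses an entry with two admissible values. The determinant is affine in that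
  -- entry, with slope plus or minus the complementary minor, which induction makes nonzero; hence
  -- one of the two values works.
  by_cases hcase1 : ∃ (σ : Equiv.Perm s) (s₀ : s),
      (∀ t, ∃ x ∈ val (r t) (c (σ t)), x ≠ 0) ∧ (val (r s₀) (c (σ s₀))).Nontrivial
  · obtain ⟨σ, s₀, hσ, v₁, hv₁, v₂, hv₂, hv⟩ := hcase1
    obtain ⟨B, hB, hdet⟩ := ih (Fintype.card {t // t ≠ s₀})
      (by rw [← hN]; exact Fintype.card_subtype_lt (x := s₀) (by simp)) {t // t ≠ s₀}
      (fun t => r t) (fun t => c (σ t)) (hr.comp Subtype.val_injective)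
      ((hc.comp σ.injective).comp Subtype.val_injective) (fun t => hσ t) rfl
    let B' : F → Matrix ι κ F := fun v a b => if a = r s₀ ∧ b = c (σ s₀) then v else B a b
    have hB'app : ∀ v a b, B' v a b = if a = r s₀ ∧ b = c (σ s₀) then v else B a b :=
      fun _ _ _ => rfl
    have hB' : ∀ v ∈ val (r s₀) (c (σ s₀)), ∀ a b, B' v a b ∈ val a b := by
      intro v hv a b
      by_cases h : a = r s₀ ∧ b = c (σ s₀)
      · simp only [B', h, and_self, if_true]; exact hv
      · simp only [B', h, if_false]; exact hB a b
    have hkey := det_sub_det_of_eq_off ((B' v₁).submatrix r (c ∘ σ)) ((B' v₂).submatrix r (c ∘ σ))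
      s₀ (by
        intro a b hab
        have : ¬ (r a = r s₀ ∧ c (σ b) = c (σ s₀)) := by
          rintro ⟨h1, h2⟩
          rcases hab with h | h
          · exact h (hr h1)
          · exact h (σ.injective (hc h2))
        simp only [Matrix.submatrix_apply, hB'app, Function.comp_apply, this, if_false])
    have hminor : ((B' v₂).submatrix r (c ∘ σ)).submatrix
        (Subtype.val : {t // t ≠ s₀} → s) Subtype.val =
        B.submatrix (fun t : {t // t ≠ s₀} => r t) (fun t : {t // t ≠ s₀} => c (σ t)) := by
      ext ⟨a, ha⟩ ⟨b, hb⟩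
      have : ¬ (r a = r s₀ ∧ c (σ b) = c (σ s₀)) := fun h => ha (hr h.1)
      simp only [Matrix.submatrix_apply, hB'app, Function.comp_apply, this, if_false]
    rw [hminor] at hkey
    have hne' : ((B' v₁).submatrix r (c ∘ σ)).det - ((B' v₂).submatrix r (c ∘ σ)).det ≠ 0 := by
      rw [hkey]
      refine mul_ne_zero ?_ hdet
      simpa [hB'app, sub_eq_zero] using hv
    have hperm : ∀ v, ((B' v).submatrix r (c ∘ σ)).det =
        Equiv.Perm.sign σ * ((B' v).submatrix r c).det := fun v => by
      rw [← Matrix.det_permute' σ ((B' v).submatrix r c)]; rfl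
    by_cases h1 : ((B' v₁).submatrix r c).det = 0
    · refine ⟨B' v₂, hB' v₂ hv₂, fun h2 => hne' ?_⟩
      rw [hperm, hperm, h1, h2]; simp
    · exact ⟨B' v₁, hB' v₁ hv₁, h1⟩
  by_cases hcase2 : ∀ t t', (val (r t) (c t')).Subsingleton
  · choose B hB using hne
    exact ⟨B, hB, hreg s r c hr hc hnz hcase2 B hB⟩
  push Not at hcase2
  obtain ⟨a, b, hab⟩ := hcase2
  -- The entry at `(a, b)` has two values but lies on no matching. Distinct representatives of the
  -- other rows in columns other than `b` would complete to such a matching, so Hall's condition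
  -- fails for them.
  let nb : s → Finset s := fun t => {t' | ∃ x ∈ val (r t) (c t'), x ≠ 0}
  let nb' : {t // t ≠ a} → Finset s := fun t => (nb t).erase b
  have hnohall : ¬ ∃ f : {t // t ≠ a} → s, f.Injective ∧ ∀ t, f t ∈ nb' t := by
    rintro ⟨f, hf, hfn⟩
    let g : s → s := fun t => if h : t = a then b else f ⟨t, h⟩
    have hg : g.Injective := by
      intro t t' htt
      by_cases h : t = a <;> by_cases h' : t' = a
      · rw [h, h']
      · simp only [g, h, h', dif_pos, dif_neg, not_false_eq_true] at htt
        exact absurd htt.symm (Finset.ne_of_mem_erase (hfn ⟨t', h'⟩))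
      · simp only [g, h, h', dif_pos, dif_neg, not_false_eq_true] at htt
        exact absurd htt (Finset.ne_of_mem_erase (hfn ⟨t, h⟩))
      · simp only [g, h, h', dif_neg, not_false_eq_true] at htt
        simpa using hf htt
    have hga : g a = b := by simp [g]
    apply hcase1
    refine ⟨Equiv.ofBijective g (Finite.injective_iff_bijective.mp hg), a, fun t => ?_, ?_⟩
    · rw [Equiv.ofBijective_apply]
      by_cases h : t = a
      · subst h
        rw [hga]
        exact hab.exists_ne 0
      · have h2 := Finset.mem_of_mem_erase (hfn ⟨t, h⟩)
        simpa [g, h, nb] using h2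
    · rw [Equiv.ofBijective_apply, hga]
      exact hab
  rw [← Finset.all_card_le_biUnion_card_iff_exists_injective] at hnohall
  push Not at hnohall
  obtain ⟨S', hS'⟩ := hnohall
  set S : Finset s := S'.map (Function.Embedding.subtype _) with hS
  have haS : a ∉ S := by simp [hS]
  have hself : ∀ t, t ∈ nb t := fun t => by simpa [nb] using hnz t
  have hsub : S ⊆ S.biUnion nb := fun t ht => Finset.mem_biUnion.mpr ⟨t, ht, hself t⟩
  have hbi : S'.biUnion nb' = (S.biUnion nb).erase b := by
    ext y
    simp only [nb', hS, Finset.mem_biUnion, Finset.mem_erase, Finset.mem_map,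
      Function.Embedding.subtype_apply]
    constructor
    · rintro ⟨x, hx, hy, hxy⟩
      exact ⟨hy, x, ⟨x, hx, rfl⟩, hxy⟩
    · rintro ⟨hy, _, ⟨x, hx, rfl⟩, hxy⟩
      exact ⟨x, hx, hy, hxy⟩
  have hScard : S.card = S'.card := Finset.card_map _
  -- Putting `b` back adds at most one neighbour, which absorbs the strict deficiency. Together with
  -- the diagonal this gives that the neighbourhood of `S` is `S`: the matrix is block triangular,
  -- and both diagonal blocks are smaller because `S` is nonempty and misses `a`.
  have hle : (S.biUnion nb).card ≤ S.card := by
    have := Finset.pred_card_le_card_erase (s := S.biUnion nb) (a := b)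
    rw [hbi] at hS'
    omega
  have heq : S = S.biUnion nb := Finset.eq_of_subset_of_card_le hsub hle
  have hSne : S.Nonempty := by
    rw [← Finset.card_pos]
    omega
  obtain ⟨a₁, ha₁⟩ := hSne
  obtain ⟨B₁, hB₁, hdet₁⟩ := ih (Fintype.card {t // t ∉ S})
    (by rw [← hN]; exact Fintype.card_subtype_lt (x := a₁) (by simpa using ha₁)) {t // t ∉ S}
    (fun t => r t) (fun t => c t) (hr.comp Subtype.val_injective)
    (hc.comp Subtype.val_injective) (fun t => hnz t) rfl
  obtain ⟨B₂, hB₂, hdet₂⟩ := ih (Fintype.card {t // ¬ t ∉ S})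
    (by rw [← hN]; exact Fintype.card_subtype_lt (x := a) (by simpa using haS)) {t // ¬ t ∉ S}
    (fun t => r t) (fun t => c t) (hr.comp Subtype.val_injective)
    (hc.comp Subtype.val_injective) (fun t => hnz t) rfl
  let B : Matrix ι κ F := fun x y => if ∃ t ∈ S, r t = x then B₂ x y else B₁ x y
  have hBapp : ∀ x y, B x y = if ∃ t ∈ S, r t = x then B₂ x y else B₁ x y := fun _ _ => rfl
  have hB : ∀ x y, B x y ∈ val x y := by
    intro x y
    by_cases h : ∃ t ∈ S, r t = x
    · simp only [B, h, if_true]; exact hB₂ x y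
    · simp only [B, h, if_false]; exact hB₁ x y
  have hr2 : ∀ t, (∃ t' ∈ S, r t' = r t) ↔ t ∈ S := fun t =>
    ⟨fun ⟨t', h, h'⟩ => hr h' ▸ h, fun h => ⟨t, h, rfl⟩⟩
  refine ⟨B, hB, ?_⟩
  rw [Matrix.twoBlockTriangular_det _ (fun t => t ∉ S)]
  · refine mul_ne_zero ?_ ?_
    · convert hdet₁ using 2
      ext ⟨x, hx⟩ ⟨y, hy⟩
      simp [Matrix.toSquareBlockProp, hBapp, hr2, hx]
    · convert hdet₂ using 2
      ext ⟨x, hx⟩ ⟨y, hy⟩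
      rw [not_not] at hx
      simp [Matrix.toSquareBlockProp, hBapp, hr2, hx]
  · intro x hx y hy
    rw [not_not] at hx
    by_contra hxy
    apply hy
    rw [heq, Finset.mem_biUnion]
    refine ⟨x, hx, ?_⟩
    simp only [nb, Finset.mem_filter, Finset.mem_univ, true_and]
    exact ⟨_, hB (r x) (c y), hxy⟩

/-- A matrix pattern with a perfect matching is the nonzero pattern of a nonsingular matrix. -/
theorem exists_same_pattern_det_ne_zero [Infinite F] {s : Type u} [Fintype s] [DecidableEq s]
    (A : Matrix s s F) (h : ∀ t, A t t ≠ 0) :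
    ∃ B : Matrix s s F, (∀ a b, B a b = 0 ↔ A a b = 0) ∧ B.det ≠ 0 := by
  classical
  -- With a value besides `0` and `1`, every nonzero position has two admissible values, so the only
  -- single-valued block with nonzero diagonal is the empty one.
  obtain ⟨x, hx⟩ := Infinite.exists_notMem_finset ({0, 1} : Finset F)
  simp only [Finset.mem_insert, Finset.mem_singleton, not_or] at hx
  let val : s → s → Set F := fun a b => {y | y = 0 ↔ A a b = 0}
  obtain ⟨B, hB, hdet⟩ := exists_det_ne_zero_of_matching.{u} val (fun a b => ⟨A a b, Iff.rfl⟩)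
    (by
      intro s' _ _ r c _ _ hnz hsub B hB
      have : IsEmpty s' := by
        refine ⟨fun t => ?_⟩
        obtain ⟨y, hy, hy0⟩ := hnz t
        have hA : A (r t) (c t) ≠ 0 := fun h => hy0 (hy.mpr h)
        have := hsub t t (show x ∈ val _ _ by simp [val, hA, hx.1])
          (show (1 : F) ∈ val _ _ by simp [val, hA])
        exact hx.2 this
      rw [Matrix.det_isEmpty]
      exact one_ne_zero)
    s id id Function.injective_id Function.injective_id (fun t => ⟨A t t, Iff.rfl, h t⟩)
  exact ⟨B, hB, by simpa using hdet⟩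

end MixedMatrix

/-! ### Vertex disjoint paths and permutations -/

section Paths

variable {V E : Type*} {k : ℕ}

/-- The cyclic successor along a duplicate-free chain. -/
theorem formPerm_rel_or_eq {α : Type*} [DecidableEq α] {R : α → α → Prop} {l : List α}
    (hl : l.Nodup) (hR : l.IsChain R) {y : α} (hy : y ∈ l) :
    R y (l.formPerm y) ∨ (l.getLast? = some y ∧ l.head? = some (l.formPerm y)) := by
  obtain ⟨i, hi, rfl⟩ := List.getElem_of_mem hy
  by_cases h : i + 1 < l.length
  · left
    rw [List.formPerm_apply_lt_getElem l hl i h]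
    exact List.isChain_iff_getElem.mp hR i h
  · right
    obtain rfl : i = l.length - 1 := by omega
    rw [List.formPerm_apply_getElem l hl]
    constructor
    · rw [List.getLast?_eq_getElem?, List.getElem?_eq_getElem hi]
    · rw [List.head?_eq_getElem?, List.getElem?_eq_getElem (by omega)]
      congr 2
      rw [Nat.sub_add_cancel (by omega), Nat.mod_self]

/-- Every edge ends in an internal vertex, so a path can be external only at its start. -/
theorem exists_map_inl_of_isChain {adj : V ⊕ E → V ⊕ E → Prop}
    (hadj : ∀ u v, adj u v → ∃ j, v = Sum.inl j) (l : List (V ⊕ E)) (u : V ⊕ E)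
    (h : (u :: l).IsChain adj) : ∃ vs : List V, l = vs.map Sum.inl := by
  induction l generalizing u with
  | nil => exact ⟨[], rfl⟩
  | cons v l ih =>
    rw [List.isChain_cons_cons] at h
    obtain ⟨j, rfl⟩ := hadj u v h.1
    obtain ⟨vs, rfl⟩ := ih _ h.2
    exact ⟨j :: vs, rfl⟩

/-- Vertex disjoint paths from external to internal vertices, closed up to cycles through
auxiliary vertices `Sum.inr s`, give a permutation. -/
theorem exists_injective_of_disjoint_paths [Finite V] {adj : V ⊕ E → V ⊕ E → Prop}
    (hadj : ∀ u v, adj u v → ∃ j, v = Sum.inl j) (X : Set E) (A : Set V)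
    (p : Fin k → List (V ⊕ E)) (hp : ∀ s, IsPath adj (Sum.inr '' X) (Sum.inl '' A) (p s))
    (hd : ∀ s t, s ≠ t → (p s).Disjoint (p t)) :
    ∃ (x : Fin k → E) (a : Fin k → V) (τ : V ⊕ Fin k → V ⊕ Fin k),
      x.Injective ∧ (∀ s, x s ∈ X) ∧ a.Injective ∧ (∀ s, a s ∈ A) ∧ τ.Injective ∧
      (∀ v w, τ (Sum.inl v) = Sum.inl w → v = w ∨ adj (Sum.inl v) (Sum.inl w)) ∧
      (∀ s w, τ (Sum.inr s) = Sum.inl w → adj (Sum.inr (x s)) (Sum.inl w)) ∧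
      (∀ v t, τ (Sum.inl v) = Sum.inr t → v = a t) ∧
      (∀ s t, τ (Sum.inr s) ≠ Sum.inr t) := by
  classical
  have key : ∀ s, ∃ (x : E) (vs : List V) (a : V), x ∈ X ∧ a ∈ A ∧
      p s = Sum.inr x :: vs.map Sum.inl ∧ vs.getLast? = some a := by
    intro s
    obtain ⟨hch, -, ⟨_, ⟨x, hx, rfl⟩, hhead⟩, ⟨_, ⟨a, ha, rfl⟩, hlast⟩⟩ := hp s
    obtain ⟨l, hl⟩ : ∃ l, p s = Sum.inr x :: l := by
      cases hps : p s with
      | nil => simp [hps] at hhead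
      | cons y l =>
        rw [hps, List.head?_cons, Option.some.injEq] at hhead
        exact ⟨l, by rw [hhead]⟩
    rw [hl] at hch hlast
    obtain ⟨vs, rfl⟩ := exists_map_inl_of_isChain hadj _ _ hch
    refine ⟨x, vs, a, hx, ha, hl, ?_⟩
    cases vs with
    | nil => simp at hlast
    | cons v vs =>
      rw [List.map_cons, List.getLast?_cons_cons, ← List.map_cons, List.getLast?_map] at hlast
      cases h : (v :: vs).getLast? with
      | none => simp at h
      | some b =>
        rw [h] at hlast
        simp only [Option.map_some, Option.some.injEq, Sum.inl.injEq] at hlast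
        rw [hlast]
  choose x vs a hx ha hpe hlast using key
  -- The auxiliary vertex `Sum.inr s` stands for the source `x s`. The cyclic successor along `l s`
  -- leads from the endpoint `a s` back to `Sum.inr s`.
  let emb : V ⊕ Fin k → V ⊕ E := Sum.map id x
  let l : Fin k → List (V ⊕ Fin k) := fun s => Sum.inr s :: (vs s).map Sum.inl
  have hl : ∀ s, p s = (l s).map emb := fun s => by
    simp [hpe, l, emb]
  have hnd : ∀ s, (l s).Nodup := fun s => by
    have := (hp s).2.1
    rw [hl] at this
    exact this.of_map
  have hch : ∀ s, (l s).IsChain (fun u v => adj (emb u) (emb v)) := fun s => by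
    have := (hp s).1
    rwa [hl, List.isChain_map] at this
  have hdis : ∀ s t y, y ∈ l s → y ∈ l t → s = t := by
    intro s t y hs ht
    by_contra hst
    refine hd s t hst (a := emb y) ?_ ?_
    · rw [hl]; exact List.mem_map_of_mem hs
    · rw [hl]; exact List.mem_map_of_mem ht
  have hxinj : x.Injective := by
    intro s t hst
    by_contra hne
    refine hd s t hne (a := Sum.inr (x s)) ?_ ?_
    · rw [hpe]; simp
    · rw [hpe, hst]; simp
  have hamem : ∀ s, Sum.inl (a s) ∈ l s := fun s => by
    have := List.mem_of_getLast? (hlast s)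
    simpa [l] using this
  have hainj : a.Injective := fun s t hst => hdis s t _ (hamem s) (hst ▸ hamem t)
  have hlastl : ∀ s, (l s).getLast? = some (Sum.inl (a s)) := by
    intro s
    have h := hlast s
    cases hv : vs s with
    | nil => simp [hv] at h
    | cons v vs' =>
      simp only [l, hv]
      rw [List.map_cons, List.getLast?_cons_cons, ← List.map_cons, List.getLast?_map, ← hv, h]
      rfl
  -- Cyclic successor on each path, identity elsewhere. By disjointness the chosen path is the only
  -- one through `y`.
  let τ : V ⊕ Fin k → V ⊕ Fin k := fun y =>
    if h : ∃ s, y ∈ l s then (l h.choose).formPerm y else y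
  have hτmem : ∀ s y, y ∈ l s → τ y = (l s).formPerm y := by
    intro s y hy
    have h : ∃ s, y ∈ l s := ⟨s, hy⟩
    simp only [τ, h, dif_pos]
    rw [hdis _ _ y h.choose_spec hy]
  have hτnot : ∀ y, (¬ ∃ s, y ∈ l s) → τ y = y := by
    intro y hy
    simp only [τ, hy, dif_neg, not_false_eq_true]
  have hτ : ∀ y, (∃ v, y = Sum.inl v ∧ τ y = y) ∨ adj (emb y) (emb (τ y)) ∨
      ∃ s, y = Sum.inl (a s) ∧ τ y = Sum.inr s := by
    intro y
    by_cases hy : ∃ s, y ∈ l s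
    · right
      obtain ⟨s, hs⟩ := hy
      rw [hτmem s y hs]
      refine (formPerm_rel_or_eq (hnd s) (hch s) hs).imp id fun ⟨h1, h2⟩ => ⟨s, ?_, ?_⟩
      · rw [hlastl] at h1
        exact (Option.some.inj h1).symm
      · simpa [l] using h2.symm
    · left
      rcases y with v | s
      · exact ⟨v, rfl, hτnot _ hy⟩
      · exact absurd ⟨s, by simp [l]⟩ hy
  refine ⟨x, a, τ, hxinj, hx, hainj, ha, ?_, ?_, ?_, ?_, ?_⟩
  · have hiff : ∀ s y, y ∈ l s → τ y ∈ l s := fun s y hy => by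
      rw [hτmem s y hy]
      exact List.formPerm_apply_mem_of_mem hy
    intro y z hyz
    by_cases hy : ∃ s, y ∈ l s
    · obtain ⟨s, hs⟩ := hy
      by_cases hz : ∃ t, z ∈ l t
      · obtain ⟨t, ht⟩ := hz
        have hst := hdis s t (τ y) (hiff s y hs) (hyz ▸ hiff t z ht)
        subst hst
        rw [hτmem s y hs, hτmem s z ht] at hyz
        exact (l s).formPerm.injective hyz
      · exact absurd ⟨s, (hτnot z hz) ▸ hyz ▸ hiff s y hs⟩ hz
    · by_cases hz : ∃ t, z ∈ l t
      · obtain ⟨t, ht⟩ := hz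
        exact absurd ⟨t, (hτnot y hy) ▸ hyz.symm ▸ hiff t z ht⟩ hy
      · rwa [hτnot y hy, hτnot z hz] at hyz
  · intro v w hvw
    rcases hτ (Sum.inl v) with ⟨_, _, h⟩ | h | ⟨s, _, h⟩
    · exact Or.inl (Sum.inl.inj (h.symm.trans hvw))
    · rw [hvw] at h
      exact Or.inr h
    · simp [hvw] at h
  · intro s w hsw
    rcases hτ (Sum.inr s) with ⟨_, h, _⟩ | h | ⟨s, h, _⟩
    · simp at h
    · rw [hsw] at h
      exact h
    · simp at h
  · intro v t hvt
    rcases hτ (Sum.inl v) with ⟨_, _, h⟩ | h | ⟨s, h, h'⟩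
    · simp [hvt] at h
    · rw [hvt] at h
      obtain ⟨j, hj⟩ := hadj _ _ h
      simp [emb] at hj
    · rw [hvt] at h'
      rw [Sum.inr.inj h']
      exact Sum.inl.inj h
  · intro s t hst
    rcases hτ (Sum.inr s) with ⟨_, h, _⟩ | h | ⟨s, h, _⟩
    · simp at h
    · rw [hst] at h
      obtain ⟨j, hj⟩ := hadj _ _ h
      simp [emb] at hj
    · simp at h

/-- Conversely, a permutation with these properties yields vertex disjoint paths. -/
theorem exists_disjoint_paths_of_perm [Finite V] {adj : V ⊕ E → V ⊕ E → Prop}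
    (x : Fin k → E) (hx : x.Injective) (a : Fin k → V) (τ : Equiv.Perm (V ⊕ Fin k))
    (h1 : ∀ v w, τ (Sum.inl v) = Sum.inl w → v ≠ w → adj (Sum.inl v) (Sum.inl w))
    (h2 : ∀ s w, τ (Sum.inr s) = Sum.inl w → adj (Sum.inr (x s)) (Sum.inl w))
    (h3 : ∀ v t, τ (Sum.inl v) = Sum.inr t → v = a t)
    (h4 : ∀ s t, τ (Sum.inr s) ≠ Sum.inr t) :
    ∃ p : Fin k → List (V ⊕ E),
      (∀ s, IsPath adj (Sum.inr '' Set.range x) (Sum.inl '' Set.range a) (p s)) ∧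
      ∀ s t, s ≠ t → (p s).Disjoint (p t) := by
  classical
  let emb : V ⊕ Fin k → V ⊕ E := Sum.map id x
  have hemb : emb.Injective := Function.injective_id.sumMap hx
  -- Finite order brings the orbit of an auxiliary vertex back to itself. The path from `s` follows
  -- the orbit and stops just before the first auxiliary vertex it meets again.
  have hret : ∀ s : Fin k, ∃ m, ((τ ^ (m + 1)) (Sum.inr s)).isRight = true := by
    intro s
    obtain ⟨m, hm0, hm⟩ := isOfFinOrder_iff_pow_eq_one.mp (isOfFinOrder_of_finite τ)
    refine ⟨m - 1, ?_⟩
    rw [Nat.sub_add_cancel hm0, hm]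
    rfl
  let m : Fin k → ℕ := fun s => Nat.find (hret s)
  have hm : ∀ s, ∃ t, (τ ^ (m s + 1)) (Sum.inr s) = Sum.inr t := fun s =>
    Sum.isRight_iff.mp (Nat.find_spec (hret s))
  have hlt : ∀ s i, i < m s → ∃ v, (τ ^ (i + 1)) (Sum.inr s) = Sum.inl v := fun s i hi =>
    Sum.isLeft_iff.mp (by simpa using Nat.find_min (hret s) hi)
  -- Cancelling `τ ^ i` turns a collision into `Sum.inr s = (τ ^ (i' - i)) (Sum.inr s')`; before the
  -- first return this is possible only for `i = i'`. Both simplicity and disjointness of the paths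
  -- follow.
  have hno : ∀ s s' i i', i ≤ i' → i' ≤ m s' → (τ ^ i) (Sum.inr s) = (τ ^ i') (Sum.inr s') →
      i = i' ∧ s = s' := by
    intro s s' i i' hii hi' h
    obtain ⟨d, rfl⟩ := Nat.exists_eq_add_of_le hii
    rw [pow_add, Equiv.Perm.mul_apply] at h
    have h' := (τ ^ i).injective h
    rcases d with - | d
    · simp only [pow_zero, Equiv.Perm.one_apply, Sum.inr.injEq] at h'
      exact ⟨rfl, h'⟩
    · obtain ⟨v, hv⟩ := hlt s' d (by omega)
      rw [hv] at h'
      cases h'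
  have hno' : ∀ s s' i i', i ≤ m s → i' ≤ m s' → (τ ^ i) (Sum.inr s) = (τ ^ i') (Sum.inr s') →
      i = i' ∧ s = s' := by
    intro s s' i i' hi hi' h
    rcases le_total i i' with hle | hle
    · exact hno s s' i i' hle hi' h
    · have := hno s' s i' i hle hi h.symm
      exact ⟨this.1.symm, this.2.symm⟩
  refine ⟨fun s => (List.range (m s + 1)).map fun i => emb ((τ ^ i) (Sum.inr s)),
    fun s => ⟨?_, ?_, ⟨Sum.inr (x s), ⟨x s, ⟨s, rfl⟩, rfl⟩, ?_⟩, ?_⟩, ?_⟩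
  · rw [List.isChain_map, List.isChain_range_succ]
    intro i hi
    obtain ⟨w, hw⟩ := hlt s i hi
    rw [Nat.succ_eq_add_one, hw]
    have hw' := hw
    rw [pow_succ', Equiv.Perm.mul_apply] at hw'
    rcases hy : (τ ^ i) (Sum.inr s) with v | t
    · rw [hy] at hw'
      refine h1 v w hw' ?_
      rintro rfl
      have := (hno' s s i (i + 1) hi.le hi (hy.trans hw.symm)).1
      omega
    · rw [hy] at hw'
      exact h2 t w hw'
  · refine List.Nodup.map_on ?_ List.nodup_range
    intro i hi i' hi' h
    rw [List.mem_range] at hi hi'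
    exact (hno' s s i i' (by omega) (by omega) (hemb h)).1
  · simp [List.range_succ_eq_map, emb]
  · obtain ⟨t, ht⟩ := hm s
    rw [pow_succ', Equiv.Perm.mul_apply] at ht
    refine ⟨Sum.inl (a t), ⟨a t, ⟨t, rfl⟩, rfl⟩, ?_⟩
    beta_reduce
    rw [List.range_succ, List.map_append, List.map_singleton, List.getLast?_concat]
    rcases hy : (τ ^ m s) (Sum.inr s) with v | t'
    · rw [hy] at ht
      rw [← h3 v t ht]
      rfl
    · rw [hy] at ht
      exact absurd ht (h4 t' t)
  · intro s t hst y hy hy'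
    rw [List.mem_map] at hy hy'
    obtain ⟨i, hi, rfl⟩ := hy
    obtain ⟨i', hi', h⟩ := hy'
    rw [List.mem_range] at hi hi'
    exact hst (hno' s t i i' (by omega) (by omega) (hemb h).symm).2

/-- Disjoint paths have distinct first vertices. The bound makes the supremum in `maxDisjointPaths`
an attained maximum. -/
theorem bddAbove_disjointPaths {α : Type*} [Finite α] (adj : α → α → Prop) (A B : Set α) :
    BddAbove {k : ℕ | ∃ p : Fin k → List α, (∀ s, IsPath adj A B (p s)) ∧
      ∀ s t, s ≠ t → (p s).Disjoint (p t)} := by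
  refine ⟨Nat.card α, ?_⟩
  rintro k ⟨p, hp, hd⟩
  choose a ha hh using fun s => (hp s).2.2.1
  have hinj : a.Injective := by
    intro s t hst
    by_contra hne
    exact hd s t hne (List.mem_of_head? (hh s)) (hst ▸ List.mem_of_head? (hh t))
  simpa using Nat.card_le_card_of_injective a hinj

theorem le_maxDisjointPaths {α : Type*} [Finite α] {adj : α → α → Prop} {A B : Set α}
    (p : Fin k → List α) (hp : ∀ s, IsPath adj A B (p s))
    (hd : ∀ s t, s ≠ t → (p s).Disjoint (p t)) : k ≤ maxDisjointPaths adj A B :=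
  le_csSup (bddAbove_disjointPaths adj A B) ⟨p, hp, hd⟩

theorem exists_maxDisjointPaths {α : Type*} [Finite α] (adj : α → α → Prop) (A B : Set α) :
    ∃ p : Fin (maxDisjointPaths adj A B) → List α, (∀ s, IsPath adj A B (p s)) ∧
      ∀ s t, s ≠ t → (p s).Disjoint (p t) :=
  Nat.sSup_mem (s := {k : ℕ | ∃ p : Fin k → List α, (∀ s, IsPath adj A B (p s)) ∧
      ∀ s t, s ≠ t → (p s).Disjoint (p t)})
    ⟨0, fun s => s.elim0, fun s => s.elim0, fun s => s.elim0⟩ (bddAbove_disjointPaths adj A B)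

end Paths

/-! ### Row spans, minors and bordered determinants -/

section LinearAlgebra

variable {V E F : Type*} [Field F] {k : ℕ}

/-- Span of the rows with index in `A`, restricted to the columns in `X`. -/
def rowSpan (Y : Matrix V E F) (A : Set V) (X : Set E) : Submodule F (X → F) :=
  Submodule.span F ((fun v (x : X) => Y v x) '' A)

theorem rowSpan_mono (Y : Matrix V E F) {A B : Set V} (h : A ⊆ B) (X : Set E) :
    rowSpan Y A X ≤ rowSpan Y B X :=
  Submodule.span_mono (Set.image_mono h)

theorem mem_rowSpan (Y : Matrix V E F) {A : Set V} (X : Set E) {v : V} (hv : v ∈ A) :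
    (fun x : X => Y v x) ∈ rowSpan Y A X :=
  Submodule.subset_span ⟨v, hv, rfl⟩

/-- Choose a basis of the span among the rows, then a basis of the column space of the chosen rows
among their columns. -/
theorem exists_minor_of_finrank_rowSpan [Fintype V] [Fintype E] (Y : Matrix V E F) (A : Set V)
    (X : Set E) : ∃ (a : Fin (Module.finrank F (rowSpan Y A X)) → V)
      (x : Fin (Module.finrank F (rowSpan Y A X)) → E), x.Injective ∧
      (∀ s, a s ∈ A) ∧ (∀ s, x s ∈ X) ∧ (Y.submatrix a x).det ≠ 0 := by
  classical
  obtain ⟨f, hfA, -, hf⟩ : ∃ f : Fin (Module.finrank F (rowSpan Y A X)) → X → F,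
      (∀ s, f s ∈ (fun v (x : X) => Y v x) '' A) ∧ Submodule.span F (Set.range f) =
        Submodule.span F ((fun v (x : X) => Y v x) '' A) ∧ LinearIndependent F f :=
    Submodule.exists_fun_fin_finrank_span_eq F _
  choose a ha haf using hfA
  let N : Matrix (Fin (Module.finrank F (rowSpan Y A X))) X F := Matrix.of fun s x => Y (a s) x
  have hN : N.rank = Module.finrank F (rowSpan Y A X) := by
    have h1 : LinearIndependent F N.row := by
      convert hf using 1
      funext s
      rw [← haf s]
      rfl
    simpa using h1.rank_matrix
  have hcols := Submodule.exists_fun_fin_finrank_span_eq F (Set.range N.col)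
  rw [← Matrix.rank_eq_finrank_span_cols, hN] at hcols
  obtain ⟨g, hg, -, hgi⟩ := hcols
  choose x hx using hg
  refine ⟨a, fun s => (x s : E), ?_, ha, fun s => (x s).2, ?_⟩
  · intro s t hst
    apply hgi.injective
    rw [← hx s, ← hx t, Subtype.ext hst]
  · have h2 : LinearIndependent F (Y.submatrix a (fun s => (x s : E))).col := by
      have hg : g = (Y.submatrix a (fun s => (x s : E))).col := funext fun s => (hx s).symm
      exact hg ▸ hgi
    rw [Matrix.linearIndependent_cols_iff_isUnit, Matrix.isUnit_iff_isUnit_det] at h2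
    exact h2.ne_zero

/-- Rows that are independent on the selected columns remain independent on all columns in `X`. -/
theorem le_finrank_rowSpan [Fintype E] (Y : Matrix V E F) {A : Set V} {X : Set E}
    (a : Fin k → V) (x : Fin k → E) (ha : ∀ s, a s ∈ A) (hx : ∀ s, x s ∈ X)
    (hdet : (Y.submatrix a x).det ≠ 0) : k ≤ Module.finrank F (rowSpan Y A X) := by
  classical
  have h1 : LinearIndependent F (Y.submatrix a x).row := by
    rw [Matrix.linearIndependent_rows_iff_isUnit, Matrix.isUnit_iff_isUnit_det]
    exact hdet.isUnit
  let L : (X → F) →ₗ[F] (Fin k → F) := LinearMap.funLeft F F fun s => (⟨x s, hx s⟩ : X)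
  have h2 : LinearIndependent F fun s => (fun y : X => Y (a s) y) :=
    LinearIndependent.of_comp L h1
  have h3 : LinearIndependent F
      (fun s => (⟨fun y : X => Y (a s) y, mem_rowSpan Y X (ha s)⟩ : rowSpan Y A X)) :=
    LinearIndependent.of_comp (rowSpan Y A X).subtype h2
  simpa using h3.fintype_card_le_finrank

/-- The matrix `[A B; E 0]` where row `s` of `E` has the single entry `c s` at `a s`. -/
def bordered [DecidableEq V] (A : Matrix V V F) (B : Matrix V (Fin k) F) (a : Fin k → V)
    (c : Fin k → F) : Matrix (V ⊕ Fin k) (V ⊕ Fin k) F :=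
  Matrix.fromBlocks A B (Matrix.of fun s v => if v = a s then c s else 0) 0

/-- Row `s` of the Schur complement of `A` is `-c s` times row `a s` of `A⁻¹ * B`. A minor involving
an inverse is thus traded for a determinant in the entries of `A` and `B` themselves. -/
theorem det_bordered_ne_zero_iff [Fintype V] [DecidableEq V] {A : Matrix V V F} (hA : A.det ≠ 0)
    (B : Matrix V (Fin k) F) (a : Fin k → V) (c : Fin k → F) :
    (bordered A B a c).det ≠ 0 ↔ (∀ s, c s ≠ 0) ∧ ((A⁻¹ * B).submatrix a id).det ≠ 0 := by
  let _ := Matrix.invertibleOfIsUnitDet A hA.isUnit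
  have h : (0 - (Matrix.of fun s v => if v = a s then c s else 0 : Matrix (Fin k) V F) * ⅟A * B :
      Matrix (Fin k) (Fin k) F) =
      Matrix.of fun s t => (-c s) * ((A⁻¹ * B).submatrix a id) s t := by
    ext s t
    rw [Matrix.invOf_eq_nonsing_inv, Matrix.mul_assoc]
    simp [Matrix.mul_apply (N := A⁻¹ * B)]
  rw [bordered, Matrix.det_fromBlocks₁₁, h, Matrix.det_mul_column, mul_ne_zero_iff,
    mul_ne_zero_iff, Finset.prod_ne_zero_iff]
  simp [hA]

theorem exists_perm_of_det_ne_zero {ι : Type*} [Fintype ι] [DecidableEq ι] {N : Matrix ι ι F}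
    (h : N.det ≠ 0) : ∃ τ : Equiv.Perm ι, ∀ y, N (τ y) y ≠ 0 := by
  rw [Matrix.det_apply] at h
  obtain ⟨τ, -, hτ⟩ := Finset.exists_ne_zero_of_sum_ne_zero h
  refine ⟨τ, fun y hy => hτ ?_⟩
  rw [Finset.prod_eq_zero (f := fun i => N (τ i) i) (Finset.mem_univ y) hy, smul_zero]

end LinearAlgebra

/-! ### The rank of a block of `TX` is at most the number of disjoint paths -/

namespace ParamNetwork

variable {V K : Type*} {n : ℕ}
  {M : ParamNetwork V K n} {k : ℕ}

/-- `T X`, the mapping from the external signals to the internal signals. -/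
def TX [Fintype V] [DecidableEq V] (M : ParamNetwork V K n) (θ : Fin n → ℝ) : Matrix V M.Ext (RatFunc ℝ) := M.T θ * M.X θ

/-- With `G - I` in the corner, the upper rows consist of entries of `[G - I X]`, the matrix that
`FixedEntriesRegular` speaks of. The change of sign against `I - G` does not affect whether the
minor vanishes. -/
theorem det_bordered_network_ne_zero_iff [Fintype V] [DecidableEq V] {θ : Fin n → ℝ} (hdet : (1 - M.G θ).det ≠ 0)
    (x : Fin k → M.Ext) (a : Fin k → V) (c : Fin k → RatFunc ℝ) :
    (bordered (M.G θ - 1) ((M.X θ).submatrix id x) a c).det ≠ 0 ↔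
      (∀ s, c s ≠ 0) ∧ ((M.TX θ).submatrix a x).det ≠ 0 := by
  have hneg : M.G θ - 1 = -(1 - M.G θ) := (neg_sub _ _).symm
  have hdet' : (M.G θ - 1).det ≠ 0 := by
    rw [hneg, Matrix.det_neg]
    exact mul_ne_zero (pow_ne_zero _ (by simp)) hdet
  rw [det_bordered_ne_zero_iff hdet']
  have hinv : (M.G θ - 1)⁻¹ = -(1 - M.G θ)⁻¹ := by
    apply Matrix.inv_eq_left_inv
    rw [hneg, neg_mul_neg, Matrix.nonsing_inv_mul _ hdet.isUnit]
  have hsub : ((M.G θ - 1)⁻¹ * (M.X θ).submatrix id x).submatrix a id =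
      -((M.TX θ).submatrix a x) := by
    rw [hinv]
    ext s t
    simp [TX, T, Matrix.mul_apply]
  rw [hsub, Matrix.det_neg, mul_ne_zero_iff]
  simp

theorem edge_into [DecidableEq V] (u v : M.Vertex) (h : M.Edge u v) : ∃ j, v = Sum.inl j :=
  h.imp fun _ hj => hj.1

theorem edge_of_ne_zero [DecidableEq V] {θ : Fin n → ℝ} (hθ : θ ∈ M.Θ) {u : M.Vertex} {j : V}
    (h : M.GX θ j u ≠ 0) : M.Edge u (Sum.inl j) :=
  ⟨j, rfl, fun h0 => h (h0 θ hθ)⟩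

/-- The rank of a block of `T X` is bounded by the number of vertex disjoint paths. -/
theorem finrank_rowSpan_le_b [Fintype V] [DecidableEq V] [Fintype K] {θ : Fin n → ℝ} (hθ : θ ∈ M.Θ) (hdet : (1 - M.G θ).det ≠ 0)
    (A : Set V) (X : Set M.Ext) :
    Module.finrank (RatFunc ℝ) (rowSpan (M.TX θ) A X) ≤ M.b (Sum.inr '' X) (Sum.inl '' A) := by
  obtain ⟨a, x, hxinj, ha, hx, hminor⟩ := exists_minor_of_finrank_rowSpan (M.TX θ) A X
  have hN := (det_bordered_network_ne_zero_iff hdet x a (fun _ => 1)).mpr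
    ⟨fun _ => one_ne_zero, hminor⟩
  -- Reading columns as sources and rows as targets, `τ` moves along edges. The diagonal of `G - I`
  -- is nonzero without loops in the graph, so an edge is claimed only for `v ≠ w`.
  obtain ⟨τ, hτ⟩ := exists_perm_of_det_ne_zero hN
  obtain ⟨p, hp, hd⟩ := exists_disjoint_paths_of_perm (adj := M.Edge) x hxinj a τ
    (by
      intro v w hvw hne
      have h := hτ (Sum.inl v)
      rw [hvw] at h
      refine edge_of_ne_zero hθ (u := Sum.inl v) ?_
      simpa [bordered, GX, Matrix.one_apply_ne hne.symm] using h)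
    (by
      intro s w hsw
      have h := hτ (Sum.inr s)
      rw [hsw] at h
      exact edge_of_ne_zero hθ (u := Sum.inr (x s)) (by simpa [bordered, GX] using h))
    (by
      intro v t hvt
      have h := hτ (Sum.inl v)
      rw [hvt] at h
      by_contra hne
      simp [bordered, hne] at h)
    (by
      intro s t hst
      have h := hτ (Sum.inr s)
      rw [hst] at h
      simp [bordered] at h)
  refine le_maxDisjointPaths p (fun s => ?_) hd
  obtain ⟨h1, h2, ⟨u, ⟨y, ⟨t, rfl⟩, rfl⟩, hu⟩, ⟨v, ⟨z, ⟨t', rfl⟩, rfl⟩, hv⟩⟩ := hp s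
  exact ⟨h1, h2, ⟨_, ⟨_, hx t, rfl⟩, hu⟩, ⟨_, ⟨_, ha t', rfl⟩, hv⟩⟩

end ParamNetwork

/-! ### Zero sets of real-analytic functions are null -/

section AnalyticZeros

open MeasureTheory Topology

/-- The zeros of a nonzero one-variable analytic function on an interval form a null set. -/
theorem ae_ne_zero_of_analytic_real {T : Set ℝ} (hT : IsPreconnected T) {g : ℝ → ℝ}
    (hg : AnalyticOnNhd ℝ g T) (h : ∃ t ∈ T, g t ≠ 0) : ∀ᵐ t : ℝ, t ∈ T → g t ≠ 0 := by
  obtain ⟨t₀, ht₀, hgt₀⟩ := h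
  rw [ae_iff]
  refine measure_null_of_locally_null _ fun t ht => ?_
  simp only [Classical.not_imp, not_not, Set.mem_ofPred_eq] at ht
  refine ⟨{t}, ?_, measure_singleton t⟩
  rw [mem_nhdsWithin_iff_eventually]
  rcases (hg t ht.1).eventually_eq_zero_or_eventually_ne_zero with h0 | h0
  · exact absurd (hg.eqOn_zero_of_preconnected_of_eventuallyEq_zero hT ht.1 h0 ht₀) hgt₀
  · rw [eventually_nhdsWithin_iff] at h0
    filter_upwards [h0] with u hu hu'
    simp only [Classical.not_imp, not_not] at hu'
    by_contra hne
    exact hu hne hu'.2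

/-- The zeros of a nonzero analytic function on a connected open set form a null set. -/
theorem ae_ne_zero_of_analytic {n : ℕ} {U : Set (Fin n → ℝ)} (hU : IsOpen U)
    (hc : IsPreconnected U) {f : (Fin n → ℝ) → ℝ} (hf : AnalyticOnNhd ℝ f U)
    (h : ∃ θ ∈ U, f θ ≠ 0) : ∀ᵐ θ : Fin n → ℝ, θ ∈ U → f θ ≠ 0 := by
  obtain ⟨θ₀, hθ₀, hfθ₀⟩ := h
  rw [ae_iff]
  refine measure_null_of_locally_null _ fun x hx => ?_
  simp only [Classical.not_imp, not_not, Set.mem_ofPred_eq] at hx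
  obtain ⟨r, hr, hrU⟩ := Metric.isOpen_iff.mp hU x hx.1
  -- Translation by `z - x` moves a small ball about `x` to points where `f` is nonzero. Hence on
  -- each line in this direction that meets the small ball, `f` is not identically zero and its
  -- zeros are null; slicing along parallel lines then gives a null set.
  obtain ⟨z, hz, hfz⟩ : ∃ z ∈ Metric.ball x r, f z ≠ 0 := by
    by_contra! hcon
    refine hfθ₀ (hf.eqOn_zero_of_preconnected_of_eventuallyEq_zero hc hx.1 ?_ hθ₀)
    filter_upwards [Metric.ball_mem_nhds x hr] with y hy using hcon y hy
  have hcont : ContinuousAt (fun y => f (y + (z - x))) x := by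
    have h1 : ContinuousAt f (x + (z - x)) := by
      rw [add_sub_cancel]
      exact (hf z (hrU hz)).continuousAt
    exact ContinuousAt.comp (f := fun y => y + (z - x)) h1 (by fun_prop)
  have hev : ∀ᶠ y in 𝓝 x, f (y + (z - x)) ≠ 0 ∧ y + (z - x) ∈ Metric.ball x r := by
    refine (hcont.eventually_ne (by simpa using hfz)).and ?_
    have h1 : ContinuousAt (fun y => y + (z - x)) x := by fun_prop
    exact h1.eventually_mem (Metric.isOpen_ball.mem_nhds (by simpa using hz))
  obtain ⟨δ, hδ, hball⟩ := Metric.eventually_nhds_iff_ball.mp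
    (hev.and (Metric.ball_mem_nhds x hr))
  refine ⟨Metric.ball x δ ∩ {y | f y = 0}, ?_, ?_⟩
  · rw [mem_nhdsWithin_iff_eventually]
    filter_upwards [Metric.ball_mem_nhds x hδ] with y hy hy'
    simp only [Classical.not_imp, not_not] at hy'
    exact ⟨hy, hy'.2⟩
  have hδr : ∀ y ∈ Metric.ball x δ, y ∈ Metric.ball x r := fun y hy => (hball y hy).2
  have hmeas : MeasurableSet (Metric.ball x δ ∩ {y | f y = 0})ᶜ := by
    refine MeasurableSet.compl ?_
    have hopen : IsOpen (Metric.ball x δ ∩ f ⁻¹' {0}ᶜ) := by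
      refine ContinuousOn.isOpen_inter_preimage ?_ Metric.isOpen_ball isOpen_compl_singleton
      exact hf.continuousOn.mono fun y hy => hrU (hδr y hy)
    have heq : Metric.ball x δ ∩ {y | f y = 0} =
        Metric.ball x δ \ (Metric.ball x δ ∩ f ⁻¹' {0}ᶜ) := by
      ext y
      simp
    rw [heq]
    exact Metric.isOpen_ball.measurableSet.diff hopen.measurableSet
  let L : ℝ →ₗ[ℝ] (Fin n → ℝ) := LinearMap.toSpanSingleton ℝ _ (z - x)
  have hae := ae_mem_of_ae_add_linearMap_mem L (volume : Measure ℝ)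
    (volume : Measure (Fin n → ℝ)) hmeas (fun y => ?_)
  · rw [ae_iff] at hae
    convert hae using 2
    ext y
    simp
  by_cases hy : ∃ t₀ : ℝ, y + L t₀ ∈ Metric.ball x δ
  · obtain ⟨t₀, ht₀⟩ := hy
    let T : Set ℝ := {t | y + L t ∈ Metric.ball x r}
    have hT : Convex ℝ T := by
      have := ((convex_ball x r).translate_preimage_right y).linear_preimage L
      exact this
    have hlin : L (t₀ + 1) = L t₀ + (z - x) := by
      simp [L, add_smul]
    have hg : AnalyticOnNhd ℝ (fun t => f (y + L t)) T := by
      intro t ht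
      refine AnalyticAt.fun_comp (g := f) (f := fun t => y + L t) (hf _ (hrU ht)) ?_
      exact analyticAt_const.add ((LinearMap.toContinuousLinearMap L).analyticAt t)
    have h1 := ae_ne_zero_of_analytic_real hT.isPreconnected hg
      -- One unit along the line is exactly the translation by `z - x`.
      ⟨t₀ + 1, by
        change y + L (t₀ + 1) ∈ Metric.ball x r
        rw [hlin, ← add_assoc]
        exact (hball _ ht₀).1.2, by
        rw [hlin, ← add_assoc]
        exact (hball _ ht₀).1.1⟩
    filter_upwards [h1] with t ht
    rintro ⟨h2, h3⟩
    exact ht (hδr _ h2) h3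
  · push Not at hy
    exact Filter.Eventually.of_forall fun t h => hy t h.1

end AnalyticZeros

/-! ### Analytic families of rational functions and independent parameters -/

section AnalyticFamilies

open MeasureTheory Topology

variable {n : ℕ} {U Θ : Set (Fin n → ℝ)}

/-- Families of polynomials whose coefficients are analytic functions of the parameters. -/
def analyticPoly (U : Set (Fin n → ℝ)) : Subring ((Fin n → ℝ) → Polynomial ℝ) where
  carrier := {p | ∀ k, AnalyticOnNhd ℝ (fun θ => (p θ).coeff k) U}
  mul_mem' := by
    intro p q hp hq k
    simp only [Pi.mul_apply, Polynomial.coeff_mul]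
    exact Finset.analyticOnNhd_fun_sum _ fun c _ => (hp c.1).mul (hq c.2)
  one_mem' := fun k => by
    simp only [Pi.one_apply]
    exact analyticOnNhd_const
  add_mem' := by
    intro p q hp hq k
    simp only [Pi.add_apply, Polynomial.coeff_add]
    exact (hp k).add (hq k)
  zero_mem' := fun k => by
    simp only [Pi.zero_apply]
    exact analyticOnNhd_const
  neg_mem' := by
    intro p hp k
    simp only [Pi.neg_apply, Polynomial.coeff_neg]
    exact (hp k).neg

theorem const_mem_analyticPoly (p : Polynomial ℝ) : (fun _ => p) ∈ analyticPoly U :=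
  fun _ => analyticOnNhd_const

theorem exists_coeff_ne_zero {p : Polynomial ℝ} (h : p ≠ 0) : ∃ k, p.coeff k ≠ 0 := by
  by_contra! hcon
  exact h (Polynomial.ext hcon)

theorem ae_ne_zero_of_mem_analyticPoly (hU : IsOpen U) (hc : IsPreconnected U)
    {p : (Fin n → ℝ) → Polynomial ℝ} (hp : p ∈ analyticPoly U) (h : ∃ θ ∈ U, p θ ≠ 0) :
    ∀ᵐ θ : Fin n → ℝ, θ ∈ U → p θ ≠ 0 := by
  obtain ⟨θ, hθ, hpθ⟩ := h
  obtain ⟨k, hk⟩ := exists_coeff_ne_zero hpθ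
  filter_upwards [ae_ne_zero_of_analytic hU hc (hp k) ⟨θ, hθ, hk⟩] with θ' h' hθ' h0
  exact h' hθ' (by rw [h0, Polynomial.coeff_zero])

theorem eventually_ne_zero_of_mem_analyticPoly {p : (Fin n → ℝ) → Polynomial ℝ}
    (hp : p ∈ analyticPoly U) {θ₀ : Fin n → ℝ} (hθ₀ : θ₀ ∈ U) (h : p θ₀ ≠ 0) :
    ∀ᶠ θ in 𝓝 θ₀, p θ ≠ 0 := by
  obtain ⟨k, hk⟩ := exists_coeff_ne_zero h
  filter_upwards [(hp k θ₀ hθ₀).continuousAt.eventually_ne hk] with θ hθ h0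
  exact hθ (by rw [h0, Polynomial.coeff_zero])

theorem eq_zero_of_eventually_eq_zero_of_mem_analyticPoly (hc : IsPreconnected U)
    {p : (Fin n → ℝ) → Polynomial ℝ} (hp : p ∈ analyticPoly U) {θ₀ : Fin n → ℝ} (hθ₀ : θ₀ ∈ U)
    (h : ∀ᶠ θ in 𝓝 θ₀, p θ = 0) : ∀ θ ∈ U, p θ = 0 := by
  intro θ hθ
  ext k
  refine (hp k).eqOn_zero_of_preconnected_of_eventuallyEq_zero hc hθ₀ ?_ hθ
  filter_upwards [h] with θ' h'
  simp [h']

/-- Families of rational functions that are quotients of analytic families of polynomials, the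
denominator being nonzero on `Θ`. -/
def analyticRat (U Θ : Set (Fin n → ℝ)) : Subring ((Fin n → ℝ) → RatFunc ℝ) where
  -- The quotient formula is imposed on `U` wherever `d` is nonzero, not only on `Θ`: the identity
  -- theorem needs an open connected set, while `Θ` is arbitrary.
  carrier := {f | ∃ p ∈ analyticPoly U, ∃ d ∈ analyticPoly U, (∀ θ ∈ Θ, d θ ≠ 0) ∧
    ∀ θ ∈ U, d θ ≠ 0 → f θ = algebraMap (Polynomial ℝ) (RatFunc ℝ) (p θ) /
      algebraMap (Polynomial ℝ) (RatFunc ℝ) (d θ)}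
  mul_mem' := by
    rintro f g ⟨p, hp, d, hd, hd0, hf⟩ ⟨p', hp', d', hd', hd0', hg⟩
    refine ⟨p * p', mul_mem hp hp', d * d', mul_mem hd hd',
      fun θ hθ => mul_ne_zero (hd0 θ hθ) (hd0' θ hθ), fun θ hθ h => ?_⟩
    rw [Pi.mul_apply] at h
    rw [Pi.mul_apply, hf θ hθ (left_ne_zero_of_mul h), hg θ hθ (right_ne_zero_of_mul h),
      div_mul_div_comm, Pi.mul_apply, Pi.mul_apply, map_mul, map_mul]
  one_mem' := ⟨1, one_mem _, 1, one_mem _, fun _ _ => one_ne_zero, fun θ _ _ => by simp⟩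
  add_mem' := by
    rintro f g ⟨p, hp, d, hd, hd0, hf⟩ ⟨p', hp', d', hd', hd0', hg⟩
    refine ⟨p * d' + d * p', add_mem (mul_mem hp hd') (mul_mem hd hp'), d * d', mul_mem hd hd',
      fun θ hθ => mul_ne_zero (hd0 θ hθ) (hd0' θ hθ), fun θ hθ h => ?_⟩
    rw [Pi.mul_apply] at h
    rw [Pi.add_apply, hf θ hθ (left_ne_zero_of_mul h), hg θ hθ (right_ne_zero_of_mul h),
      div_add_div _ _ (RatFunc.algebraMap_ne_zero (left_ne_zero_of_mul h))
        (RatFunc.algebraMap_ne_zero (right_ne_zero_of_mul h))]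
    simp
  zero_mem' := ⟨0, zero_mem _, 1, one_mem _, fun _ _ => one_ne_zero, fun θ _ _ => by simp⟩
  neg_mem' := by
    rintro f ⟨p, hp, d, hd, hd0, hf⟩
    refine ⟨-p, neg_mem hp, d, hd, hd0, fun θ hθ h => ?_⟩
    rw [Pi.neg_apply, hf θ hθ h, Pi.neg_apply, map_neg, neg_div]

theorem const_mem_analyticRat (g : RatFunc ℝ) : (fun _ => g) ∈ analyticRat U Θ :=
  ⟨_, const_mem_analyticPoly g.num, _, const_mem_analyticPoly g.denom,
    fun _ _ => g.denom_ne_zero, fun _ _ _ => g.num_div_denom.symm⟩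

theorem RationalFamily.value_mem_analyticRat (f : RationalFamily n U)
    (h : ∀ θ ∈ Θ, f.den θ ≠ 0) : f.value ∈ analyticRat U Θ :=
  ⟨f.num, f.num_analytic, f.den, f.den_analytic, h, fun _ _ _ => rfl⟩

theorem det_mem_analyticRat {s : Type*} [Fintype s] [DecidableEq s]
    {A : (Fin n → ℝ) → Matrix s s (RatFunc ℝ)}
    (hA : ∀ i j, (fun θ => A θ i j) ∈ analyticRat U Θ) :
    (fun θ => (A θ).det) ∈ analyticRat U Θ := by
  have h : (fun θ => (A θ).det) = ∑ σ : Equiv.Perm s,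
      ((Equiv.Perm.sign σ : ℤˣ) : ℤ) • ∏ i, fun θ => A θ (σ i) i := by
    funext θ
    rw [Matrix.det_apply]
    simp [Units.smul_def]
  rw [h]
  exact sum_mem fun σ _ => zsmul_mem (prod_mem fun i _ => hA _ _) _

/-- The nonzero values may occur outside `Θ`, where a denominator could vanish. Close to `θ₀ ∈ Θ` it
does not, so the numerator is nonzero somewhere in `U` and therefore almost everywhere in `U`. -/
theorem ae_ne_zero_of_frequently_ne_zero (hU : IsOpen U) (hc : IsPreconnected U) (hΘ : Θ ⊆ U)
    {f : (Fin n → ℝ) → RatFunc ℝ} (hf : f ∈ analyticRat U Θ) {θ₀ : Fin n → ℝ} (hθ₀ : θ₀ ∈ Θ)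
    (h : ∃ᶠ θ in 𝓝 θ₀, f θ ≠ 0) : ∀ᵐ θ : Fin n → ℝ, θ ∈ Θ → f θ ≠ 0 := by
  obtain ⟨p, hp, d, hd, hd0, hfp⟩ := hf
  obtain ⟨θ₁, h1, h2, h3⟩ := (h.and_eventually ((eventually_ne_zero_of_mem_analyticPoly hd
    (hΘ hθ₀) (hd0 θ₀ hθ₀)).and (hU.mem_nhds (hΘ hθ₀)))).exists
  have hp1 : p θ₁ ≠ 0 := by
    intro h0
    rw [hfp θ₁ h3 h2, h0] at h1
    simp at h1
  filter_upwards [ae_ne_zero_of_mem_analyticPoly hU hc hp ⟨θ₁, h3, hp1⟩] with θ hpθ hθ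
  rw [hfp θ (hΘ hθ) (hd0 θ hθ)]
  exact div_ne_zero (RatFunc.algebraMap_ne_zero (hpθ (hΘ hθ)))
    (RatFunc.algebraMap_ne_zero (hd0 θ hθ))

/-- The identity theorem for the numerator of `f - g`. It lets local constancy of an entry decide
whether the entry is known or fixed to zero on `Θ`. -/
theorem eq_of_eventually_eq (hU : IsOpen U) (hc : IsPreconnected U) (hΘ : Θ ⊆ U)
    {f : (Fin n → ℝ) → RatFunc ℝ} (hf : f ∈ analyticRat U Θ) {θ₀ : Fin n → ℝ} (hθ₀ : θ₀ ∈ Θ)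
    {g : RatFunc ℝ} (h : ∀ᶠ θ in 𝓝 θ₀, f θ = g) : ∀ θ ∈ Θ, f θ = g := by
  obtain ⟨p, hp, d, hd, hd0, hfp⟩ := sub_mem hf (const_mem_analyticRat g)
  have hp0 := eq_zero_of_eventually_eq_zero_of_mem_analyticPoly hc hp (hΘ hθ₀) (by
    filter_upwards [h, eventually_ne_zero_of_mem_analyticPoly hd (hΘ hθ₀) (hd0 θ₀ hθ₀),
      hU.mem_nhds (hΘ hθ₀)] with θ h1 h2 h3
    have h4 := hfp θ h3 h2
    rw [Pi.sub_apply, h1, sub_self] at h4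
    by_contra hne
    exact div_ne_zero (RatFunc.algebraMap_ne_zero hne) (RatFunc.algebraMap_ne_zero h2) h4.symm)
  intro θ hθ
  have h4 := hfp θ (hΘ hθ) (hd0 θ hθ)
  rw [hp0 θ (hΘ hθ), map_zero, zero_div, Pi.sub_apply, sub_eq_zero] at h4
  exact h4

/-- Functions of disjoint sets of parameters take all combinations of their values on a box. -/
theorem exists_common_parameter {ι α : Type*} (f : ι → (Fin n → ℝ) → α) (S : ι → Set (Fin n))
    (hS : ∀ e e', e ≠ e' → Disjoint (S e) (S e'))
    (hf : ∀ e, ∀ θ ∈ U, ∀ θ' ∈ U, (∀ k ∈ S e, θ k = θ' k) → f e θ = f e θ')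
    {θ₀ : Fin n → ℝ} {ε : ℝ} (hε : 0 < ε) (hW : Metric.ball θ₀ ε ⊆ U)
    (t : ι → Fin n → ℝ) (ht : ∀ e, t e ∈ Metric.ball θ₀ ε) :
    ∃ θ ∈ Metric.ball θ₀ ε, ∀ e, f e θ = f e (t e) := by
  classical
  -- A sup-norm ball is a box, so it contains every point assembled coordinatewise from its points.
  let θ : Fin n → ℝ := fun k => if h : ∃ e, k ∈ S e then t h.choose k else θ₀ k
  have hθS : ∀ e, ∀ k ∈ S e, θ k = t e k := by
    intro e k hk
    have h : ∃ e, k ∈ S e := ⟨e, hk⟩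
    have he : h.choose = e := by
      by_contra hne
      exact Set.disjoint_left.mp (hS _ _ hne) h.choose_spec hk
    simp only [θ, h, dif_pos, he]
  have hθ : θ ∈ Metric.ball θ₀ ε := by
    rw [Metric.mem_ball, dist_pi_lt_iff hε]
    intro k
    by_cases h : ∃ e, k ∈ S e
    · obtain ⟨e, hk⟩ := h
      rw [hθS e k hk]
      exact (dist_pi_lt_iff hε).mp (ht e) k
    · simp only [θ, h, dif_neg, not_false_eq_true, dist_self, hε]
  exact ⟨θ, hθ, fun e => hf e _ (hW hθ) _ (hW (ht e)) (hθS e)⟩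

end AnalyticFamilies

/-! ### Structural rank and nonsingularity -/

section StructuralRank

variable {F : Type*} [Field F]

theorem det_ne_zero_of_card_le_rank {s : Type*} [Fintype s] [DecidableEq s] {A : Matrix s s F}
    (h : Fintype.card s ≤ A.rank) : A.det ≠ 0 := by
  have h1 : LinearIndependent F A.row := by
    rw [linearIndependent_iff_card_le_finrank_span]
    rwa [A.rank_eq_finrank_span_row] at h
  rw [Matrix.linearIndependent_rows_iff_isUnit, Matrix.isUnit_iff_isUnit_det] at h1
  exact h1.ne_zero

/-- A square matrix of full structural rank whose rank is the structural rank is nonsingular. -/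
theorem det_ne_zero_of_rank_eq_structuralRank [Infinite F] {m l s : Type*} [Fintype m] [Fintype l]
    [Fintype s] [DecidableEq s] (A : Matrix m l F) (e₁ : s ≃ m) (e₂ : s ≃ l)
    (h : ∀ t, A (e₁ t) (e₂ t) ≠ 0) (hrank : A.rank = structuralRank A) :
    (A.submatrix e₁ e₂).det ≠ 0 := by
  obtain ⟨B, hB, hdet⟩ := exists_same_pattern_det_ne_zero (A.submatrix e₁ e₂) h
  apply det_ne_zero_of_card_le_rank
  rw [Matrix.rank_submatrix, hrank]
  refine le_csSup ⟨Fintype.card m, ?_⟩ ⟨B.submatrix e₁.symm e₂.symm, fun i j => ?_, ?_⟩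
  · rintro r ⟨C, -, rfl⟩
    exact C.rank_le_card_height
  · simpa using hB (e₁.symm i) (e₂.symm j)
  · rw [Matrix.rank_submatrix]
    exact Matrix.rank_of_isUnit B ((Matrix.isUnit_iff_isUnit_det B).mpr hdet.isUnit)

end StructuralRank

/-- Scaling of the border rows. It reduces the auxiliary border values used for choosing entries to
ones. -/
theorem det_bordered_eq_prod_mul {V F : Type*} [Field F] [Fintype V] [DecidableEq V] {k : ℕ}
    (A : Matrix V V F) (B : Matrix V (Fin k) F) (a : Fin k → V) (c : Fin k → F) :
    (bordered A B a c).det = (∏ s, c s) * (bordered A B a fun _ => 1).det := by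
  have h : bordered A B a c = Matrix.of fun i j =>
      (Sum.elim (fun _ : V => (1 : F)) c) i * (bordered A B a fun _ => 1) i j := by
    ext i j
    rcases i with i | i <;> rcases j with j | j <;> simp [bordered]
  rw [h, Matrix.det_mul_column]
  simp

/-! ### Generically the rank of a block of `TX` reaches the number of disjoint paths -/

namespace ParamNetwork

open MeasureTheory Topology

variable {V K : Type*} [DecidableEq V] {n : ℕ} {M : ParamNetwork V K n} {k : ℕ}

theorem GX_mem_analyticRat (hM_G : ∀ θ ∈ M.Θ, ∀ j i, (M.Gfam j i).den θ ≠ 0)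
    (hM_H : ∀ θ ∈ M.Θ, ∀ j k, (M.Hfam j k).den θ ≠ 0) (j : V) (u : M.Vertex) :
    (fun θ => M.GX θ j u) ∈ analyticRat M.domain M.Θ := by
  rcases u with i | p | e
  · exact (M.Gfam j i).value_mem_analyticRat fun θ hθ => hM_G θ hθ j i
  · exact const_mem_analyticRat _
  · by_cases h : j ∈ M.meas
    · convert (M.Hfam ⟨j, h⟩ e).value_mem_analyticRat (Θ := M.Θ)
        fun θ hθ => hM_H θ hθ ⟨j, h⟩ e using 1
      funext θ
      simp [GX, X, Hfull, H, h]
    · convert const_mem_analyticRat (U := M.domain) (Θ := M.Θ) 0 using 1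
      funext θ
      simp [GX, X, Hfull, h]

/-- The entries of `R` and the zero rows of the noise model are constant and receive the empty
parameter set. -/
theorem exists_parameter_sets (hind : M.IndependentlyParameterized) :
    ∃ S : V × M.Vertex → Set (Fin n), (∀ e e', e ≠ e' → Disjoint (S e) (S e')) ∧
      ∀ e, ∀ θ ∈ M.domain, ∀ θ' ∈ M.domain, (∀ k ∈ S e, θ k = θ' k) →
        M.GX θ e.1 e.2 = M.GX θ' e.1 e.2 := by
  classical
  obtain ⟨S, hS, hG, hH⟩ := hind
  let S' : V × M.Vertex → Set (Fin n)
    | (j, Sum.inl i) => S (Sum.inl (j, i))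
    | (_, Sum.inr (Sum.inl _)) => ∅
    | (j, Sum.inr (Sum.inr e)) => if h : j ∈ M.meas then S (Sum.inr (⟨j, h⟩, e)) else ∅
  refine ⟨S', ?_, ?_⟩
  · rintro ⟨j, i | p | e⟩ ⟨j', i' | p' | e'⟩ hne
    · exact hS _ _ fun h => hne (by simpa using h)
    · exact Set.disjoint_empty _
    · simp only [S']
      split_ifs
      · exact hS _ _ (by simp)
      · exact Set.disjoint_empty _
    · exact Set.empty_disjoint _
    · exact Set.empty_disjoint _
    · exact Set.empty_disjoint _
    · simp only [S']
      split_ifs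
      · exact hS _ _ (by simp)
      · exact Set.empty_disjoint _
    · exact Set.disjoint_empty _
    · simp only [S']
      split_ifs
      · exact hS _ _ fun h => hne (by simpa using h)
      · exact Set.disjoint_empty _
      · exact Set.empty_disjoint _
      · exact Set.empty_disjoint _
  · rintro ⟨j, i | p | e⟩ θ hθ θ' hθ' h
    · obtain ⟨h1, h2⟩ := hG j i θ hθ θ' hθ' h
      simp [GX, G, RationalFamily.value, h1, h2]
    · simp [GX, X]
    · by_cases hj : j ∈ M.meas
      · simp only [S', hj, dif_pos] at h
        obtain ⟨h1, h2⟩ := hH ⟨j, hj⟩ e θ hθ θ' hθ' h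
        simp [GX, X, Hfull, H, hj, RationalFamily.value, h1, h2]
      · simp [GX, X, Hfull, hj]

/-- The entries of `[G - I  X]`. -/
def GIX (M : ParamNetwork V K n) (θ : Fin n → ℝ) : Matrix V M.Vertex (RatFunc ℝ) :=
  Matrix.fromCols (M.G θ - 1) (M.X θ)

theorem GIX_eq (θ : Fin n → ℝ) (j : V) (u : M.Vertex) :
    M.GIX θ j u = M.GX θ j u -
      Sum.elim (fun i => (1 : Matrix V V (RatFunc ℝ)) j i) (fun _ => 0) u := by
  rcases u with i | e
  · rfl
  · exact (sub_zero _).symm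

/-- A fixed block of `[G - I  X]` whose pattern has a perfect matching is nonsingular. -/
theorem det_submatrix_GIX_ne_zero [Fintype V] [Fintype K] (hfix : M.FixedEntriesRegular)
    {s : Type*} [Fintype s] [DecidableEq s] (r : s → V) (c : s → M.Vertex) (hr : r.Injective)
    (hc : c.Injective) {θ : Fin n → ℝ} (hθ : θ ∈ M.Θ) (hdiag : ∀ t, M.GIX θ (r t) (c t) ≠ 0)
    (hfixed : ∀ t t', ∀ θ' ∈ M.Θ, M.GIX θ' (r t) (c t') = M.GIX θ (r t) (c t')) :
    ((M.GIX θ).submatrix r c).det ≠ 0 := by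
  classical
  have h := hfix (Finset.univ.image r) (Finset.univ.image c)
  let e₁ : s ≃ (Finset.univ.image r : Finset V) :=
    (Equiv.ofInjective r hr).trans (Equiv.subtypeEquivRight fun v => by simp)
  let e₂ : s ≃ (Finset.univ.image c : Finset M.Vertex) :=
    (Equiv.ofInjective c hc).trans (Equiv.subtypeEquivRight fun v => by simp)
  have h1 : ∀ t, ((e₁ t : (Finset.univ.image r : Finset V)) : V) = r t := fun t => rfl
  have h2 : ∀ t, ((e₂ t : (Finset.univ.image c : Finset M.Vertex)) : M.Vertex) = c t :=
    fun t => rfl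
  have hrank := h (by
    intro θ₁ hθ₁ θ₂ hθ₂
    ext i j
    obtain ⟨t, rfl⟩ := e₁.surjective i
    obtain ⟨t', rfl⟩ := e₂.surjective j
    exact (hfixed t t' θ₁ hθ₁).trans (hfixed t t' θ₂ hθ₂).symm) θ hθ
  exact det_ne_zero_of_rank_eq_structuralRank _ e₁ e₂ hdiag hrank

/-- If there are `k` vertex disjoint paths, then arbitrarily close to any parameter there is one
for which the corresponding bordered matrix is nonsingular. -/
theorem frequently_det_bordered_ne_zero [Fintype V] [Fintype K] (hM : M.IsModelSet)
    (hind : M.IndependentlyParameterized) (hfix : M.FixedEntriesRegular)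
    (x : Fin k → M.Ext) (hx : x.Injective)
    (a : Fin k → V) (τ : V ⊕ Fin k → V ⊕ Fin k) (hτ : τ.Injective)
    (h1 : ∀ v w, τ (Sum.inl v) = Sum.inl w → v = w ∨ M.Edge (Sum.inl v) (Sum.inl w))
    (h2 : ∀ s w, τ (Sum.inr s) = Sum.inl w → M.Edge (Sum.inr (x s)) (Sum.inl w))
    (h3 : ∀ v t, τ (Sum.inl v) = Sum.inr t → v = a t)
    (h4 : ∀ s t, τ (Sum.inr s) ≠ Sum.inr t) {θ₀ : Fin n → ℝ} (hθ₀ : θ₀ ∈ M.Θ) :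
    ∃ᶠ θ in 𝓝 θ₀,
      (bordered (M.G θ - 1) ((M.X θ).submatrix id x) a fun _ => 1).det ≠ 0 := by
  classical
  let cm : V ⊕ Fin k → M.Vertex := Sum.map id x
  have hcm : cm.Injective := Function.injective_id.sumMap hx
  have han : ∀ j u, (fun θ => M.GIX θ j u) ∈ analyticRat M.domain M.Θ := by
    intro j u
    have := sub_mem (GX_mem_analyticRat hM.G_den_ne_zero hM.H_den_ne_zero j u)
      (const_mem_analyticRat (U := M.domain) (Θ := M.Θ) 
        (Sum.elim (fun i => (1 : Matrix V V (RatFunc ℝ)) j i) (fun _ => 0) u))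
    convert this using 1
    funext θ
    exact GIX_eq θ j u
  have hU := hM.domain_isOpen
  have hcon := hM.domain_isPreconnected
  have hsub := hM.subset_domain
  rw [Metric.nhds_basis_ball.frequently_iff]
  intro ε₁ hε₁
  obtain ⟨ε₂, hε₂, hball⟩ := Metric.isOpen_iff.mp hU θ₀ (hsub hθ₀)
  obtain ⟨ε, hε, hle₁, hle₂⟩ : ∃ ε, 0 < ε ∧ ε ≤ ε₁ ∧ ε ≤ ε₂ :=
    ⟨min ε₁ ε₂, lt_min hε₁ hε₂, min_le_left _ _, min_le_right _ _⟩
  have hW : ∀ θ ∈ Metric.ball θ₀ ε, θ ∈ Metric.ball θ₀ ε₂ := fun θ hθ =>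
    Metric.ball_subset_ball hle₂ hθ
  -- An entry with a single value on the ball is the same throughout `Θ`, so single-valued blocks
  -- are blocks to which `FixedEntriesRegular` applies.
  have hknown : ∀ j u, (((fun θ => M.GIX θ j u) '' Metric.ball θ₀ ε).Subsingleton) →
      ∀ θ ∈ M.Θ, M.GIX θ j u = M.GIX θ₀ j u := by
    intro j u hss
    refine eq_of_eventually_eq hU hcon hsub (han j u) hθ₀ ?_
    filter_upwards [Metric.ball_mem_nhds θ₀ hε] with θ hθ
    exact hss ⟨θ, hθ, rfl⟩ ⟨θ₀, Metric.mem_ball_self hε, rfl⟩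
  have hnonzero : ∀ j u, (∃ θ ∈ M.Θ, M.GIX θ j u ≠ 0) →
      ∃ z ∈ (fun θ => M.GIX θ j u) '' Metric.ball θ₀ ε, z ≠ 0 := by
    rintro j u ⟨θ, hθ, hne⟩
    by_contra! hz
    apply hne
    refine eq_of_eventually_eq hU hcon hsub (han j u) hθ₀ ?_ θ hθ
    filter_upwards [Metric.ball_mem_nhds θ₀ hε] with θ' hθ'
    exact hz _ ⟨θ', hθ', rfl⟩
  -- The border entries get two values, `1` and `2`, instead of one: then a single-valued block with
  -- nonzero diagonal contains no auxiliary row and is a block of `[G - I X]`.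
  let val : V ⊕ Fin k → V ⊕ Fin k → Set (RatFunc ℝ)
    | Sum.inl j, z => (fun θ => M.GIX θ j (cm z)) '' Metric.ball θ₀ ε
    | Sum.inr s, Sum.inl v => if v = a s then {1, 2} else {0}
    | Sum.inr _, Sum.inr _ => {0}
  have hθball : θ₀ ∈ Metric.ball θ₀ ε := Metric.mem_ball_self hε
  obtain ⟨B, hB, hdet⟩ := exists_det_ne_zero_of_matching val
    (by
      rintro (j | s) z
      · exact ⟨_, θ₀, hθball, rfl⟩
      · rcases z with v | t
        · simp only [val]
          split_ifs <;> simp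
        · simp [val])
    (by
      intro s _ _ r c hr hc hnz hss B hB
      have hrinl : ∀ t, ∃ j, r t = Sum.inl j := by
        intro t
        cases hrt : r t with
        | inl j => exact ⟨j, rfl⟩
        | inr i =>
          exfalso
          obtain ⟨y, hy, hy0⟩ := hnz t
          have hsst := hss t t
          rw [hrt] at hy hsst
          cases hct : c t with
          | inl v =>
            rw [hct] at hy hsst
            by_cases hv : v = a i
            · simp only [val, hv, if_true] at hsst
              have h12 : (1 : RatFunc ℝ) = 2 := hsst (by simp) (by simp)
              norm_num at h12
            · simp [val, hv, hy0] at hy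
          | inr t' =>
            rw [hct] at hy
            simp [val, hy0] at hy
      choose r' hr' using hrinl
      have hfixed : ∀ t t', ∀ θ ∈ M.Θ,
          M.GIX θ (r' t) (cm (c t')) = M.GIX θ₀ (r' t) (cm (c t')) := by
        intro t t'
        refine hknown _ _ ?_
        have := hss t t'
        rwa [hr' t] at this
      have hBeq : B.submatrix r c = (M.GIX θ₀).submatrix r' (cm ∘ c) := by
        ext t t'
        have h5 := hB (r t) (c t')
        have h6 := hss t t'
        rw [hr' t] at h5 h6
        rw [Matrix.submatrix_apply, hr' t]
        exact h6 h5 ⟨θ₀, hθball, rfl⟩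
      rw [hBeq]
      refine det_submatrix_GIX_ne_zero hfix r' (cm ∘ c) ?_ (hcm.comp hc) hθ₀ ?_ hfixed
      · intro t t' htt
        apply hr
        rw [hr', hr', htt]
      · intro t
        obtain ⟨y, hy, hy0⟩ := hnz t
        have hsst := hss t t
        rw [hr' t] at hy hsst
        have : y = M.GIX θ₀ (r' t) (cm (c t)) := hsst hy ⟨θ₀, hθball, rfl⟩
        rw [Function.comp_apply, ← this]
        exact hy0)
    -- The matching pairs row `τ y` with column `y`. At a vertex fixed by `τ` it uses the diagonal
    -- entry `-1` of `G - I`.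
    (V ⊕ Fin k) τ id hτ Function.injective_id
    (by
      have hedge : ∀ j u, u ≠ Sum.inl j → M.Edge u (Sum.inl j) →
          ∃ z ∈ (fun θ => M.GIX θ j u) '' Metric.ball θ₀ ε, z ≠ 0 := by
        rintro j u hne ⟨j', hj', hnz⟩
        obtain rfl := Sum.inl.inj hj'
        apply hnonzero
        unfold IsFixedZero at hnz
        push Not at hnz
        obtain ⟨θ, hθ, hne'⟩ := hnz
        refine ⟨θ, hθ, ?_⟩
        rw [GIX_eq]
        rcases u with i | e
        · rw [Sum.elim_inl, Matrix.one_apply_ne (fun h => hne (by rw [h])), sub_zero]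
          exact hne'
        · rw [Sum.elim_inr, sub_zero]
          exact hne'
      rintro (v | s)
      · cases hv : τ (Sum.inl v) with
        | inl w =>
          by_cases hvw : v = w
          · subst hvw
            refine hnonzero v (Sum.inl v) ⟨θ₀, hθ₀, ?_⟩
            have h0 : M.GX θ₀ v (Sum.inl v) = 0 := hM.G_hollow θ₀ hθ₀ v
            rw [GIX_eq, h0]
            simp
          · exact hedge w (Sum.inl v) (by simpa using hvw) ((h1 v w hv).resolve_left hvw)
        | inr t =>
          refine ⟨1, ?_, one_ne_zero⟩
          simp [val, h3 v t hv]
      · cases hs : τ (Sum.inr s) with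
        | inl w => exact hedge w (Sum.inr (x s)) (by simp) (h2 s w hs)
        | inr t => exact absurd hs (h4 s t))
  obtain ⟨S, hS, hdep⟩ := exists_parameter_sets hind
  have hent : ∀ e : V × (V ⊕ Fin k), ∃ θ ∈ Metric.ball θ₀ ε,
      M.GIX θ e.1 (cm e.2) = B (Sum.inl e.1) e.2 := fun e => hB (Sum.inl e.1) e.2
  choose t ht htB using hent
  -- So far each entry of `B` is attained at a parameter of its own; independence merges these into
  -- one.
  obtain ⟨θ, hθ, hθt⟩ := exists_common_parameter (U := M.domain)
    (fun (e : V × (V ⊕ Fin k)) θ => M.GIX θ e.1 (cm e.2)) (fun e => S (e.1, cm e.2))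
    (by
      intro e e' hne
      refine hS _ _ fun h => hne ?_
      rw [Prod.mk.injEq] at h
      exact Prod.ext h.1 (hcm h.2))
    (by
      intro e θ hθ θ' hθ' h
      simp only [GIX_eq]
      rw [hdep (e.1, cm e.2) θ hθ θ' hθ' h])
    hε (fun θ hθ => hball (hW θ hθ)) t ht
  refine ⟨θ, Metric.ball_subset_ball hle₁ hθ, ?_⟩
  have hBb : B = bordered (M.G θ - 1) ((M.X θ).submatrix id x) a
      fun s => B (Sum.inr s) (Sum.inl (a s)) := by
    ext i z
    rcases i with j | s
    · rw [← htB (j, z), ← hθt (j, z)]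
      rcases z with v | s <;> rfl
    · have h5 := hB (Sum.inr s) z
      rcases z with v | t'
      · by_cases hv : v = a s
        · simp [bordered, hv]
        · simp only [val, hv, if_false, Set.mem_singleton_iff] at h5
          simp [bordered, hv, h5]
      · simp only [val, Set.mem_singleton_iff] at h5
        simp [bordered, h5]
  intro h0
  apply hdet
  have hperm : (B.submatrix τ id).det = 0 := by
    have hsign := Matrix.det_permute (Equiv.ofBijective τ (Finite.injective_iff_bijective.mp hτ)) B
    have h6 : B.det = 0 := by
      rw [hBb, det_bordered_eq_prod_mul, h0, mul_zero]
    rw [h6, mul_zero] at hsign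
    exact hsign
  exact hperm

/-- Generically the rank of a block of `T X` is at least the number of vertex disjoint paths. -/
theorem ae_b_le_finrank_rowSpan [Fintype V] [Fintype K] (hM : M.IsModelSet)
    (hdet : ∀ θ ∈ M.Θ, (1 - M.G θ).det ≠ 0)
    (hind : M.IndependentlyParameterized) (hfix : M.FixedEntriesRegular)
    (A : Set V) (X : Set M.Ext) :
    ∀ᵐ θ : Fin n → ℝ, θ ∈ M.Θ → M.b (Sum.inr '' X) (Sum.inl '' A) ≤
      Module.finrank (RatFunc ℝ) (rowSpan (M.TX θ) A X) := by
  rcases M.Θ.eq_empty_or_nonempty with hΘ | ⟨θ₀, hθ₀⟩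
  · exact Filter.Eventually.of_forall fun θ hθ => by simp [hΘ] at hθ
  obtain ⟨p, hp, hd⟩ := exists_maxDisjointPaths M.Edge (Sum.inr '' X) (Sum.inl '' A)
  obtain ⟨x, a, τ, hx, hxX, -, haA, hτ, h1, h2, h3, h4⟩ :=
    exists_injective_of_disjoint_paths edge_into X A p hp hd
  have hfreq := frequently_det_bordered_ne_zero hM hind hfix x hx a τ hτ h1 h2 h3 h4 hθ₀
  have han : (fun θ => (bordered (M.G θ - 1) ((M.X θ).submatrix id x) a fun _ => 1).det) ∈
      analyticRat M.domain M.Θ := by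
    refine det_mem_analyticRat ?_
    have hGX := GX_mem_analyticRat hM.G_den_ne_zero hM.H_den_ne_zero
    rintro (j | s) (v | t)
    · exact sub_mem (hGX j (Sum.inl v)) (const_mem_analyticRat ((1 : Matrix V V (RatFunc ℝ)) j v))
    · exact hGX j (Sum.inr (x t))
    · exact const_mem_analyticRat (if v = a s then 1 else 0)
    · exact const_mem_analyticRat 0
  filter_upwards [ae_ne_zero_of_frequently_ne_zero hM.domain_isOpen hM.domain_isPreconnected
    hM.subset_domain han hθ₀ hfreq] with θ hθ hθΘ
  exact le_finrank_rowSpan _ a x haA hxX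
    ((det_bordered_network_ne_zero_iff (hdet θ hθΘ) x a _).mp (hθ hθΘ)).2

end ParamNetwork

/-! ### Proper rational functions and their values at infinity -/

section Proper

/-- Cross-multiplication carries the degree inequality over to the reduced fraction. -/
theorem isProper_div {p q : Polynomial ℝ} (hq : q ≠ 0) (h : p.degree ≤ q.degree) :
    IsProper (algebraMap (Polynomial ℝ) (RatFunc ℝ) p / algebraMap (Polynomial ℝ) (RatFunc ℝ) q) := by
  set g := algebraMap (Polynomial ℝ) (RatFunc ℝ) p / algebraMap (Polynomial ℝ) (RatFunc ℝ) q
  have h1 : g.num * q = p * g.denom := (RatFunc.num_mul_eq_mul_denom_iff hq).mpr rfl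
  have h2 := congrArg Polynomial.degree h1
  rw [Polynomial.degree_mul, Polynomial.degree_mul] at h2
  have h3 : g.num.degree + q.degree ≤ g.denom.degree + q.degree := by
    rw [h2, add_comm]
    gcongr
  rw [Polynomial.degree_eq_natDegree hq] at h3
  exact (WithBot.add_le_add_iff_right (by simp)).mp h3

theorem isProper_C (c : ℝ) : IsProper (RatFunc.C c) := by
  rw [IsProper, RatFunc.num_C, RatFunc.denom_C, Polynomial.degree_one]
  exact Polynomial.degree_C_le

theorem valueAtInfty_C (c : ℝ) : valueAtInfty (RatFunc.C c) = c := by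
  simp [valueAtInfty, RatFunc.num_C, RatFunc.denom_C]

theorem IsProper.add {f g : RatFunc ℝ} (hf : IsProper f) (hg : IsProper g) : IsProper (f + g) := by
  rw [← f.num_div_denom, ← g.num_div_denom,
    div_add_div _ _ (RatFunc.algebraMap_ne_zero f.denom_ne_zero)
      (RatFunc.algebraMap_ne_zero g.denom_ne_zero), ← map_mul, ← map_mul, ← map_mul, ← map_add]
  refine isProper_div (mul_ne_zero f.denom_ne_zero g.denom_ne_zero) ?_
  refine (Polynomial.degree_add_le _ _).trans (max_le ?_ ?_)
  · rw [Polynomial.degree_mul, Polynomial.degree_mul]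
    exact add_le_add hf le_rfl
  · rw [Polynomial.degree_mul, Polynomial.degree_mul]
    exact add_le_add le_rfl hg

theorem IsProper.mul {f g : RatFunc ℝ} (hf : IsProper f) (hg : IsProper g) : IsProper (f * g) := by
  rw [← f.num_div_denom, ← g.num_div_denom, div_mul_div_comm, ← map_mul, ← map_mul]
  refine isProper_div (mul_ne_zero f.denom_ne_zero g.denom_ne_zero) ?_
  rw [Polynomial.degree_mul, Polynomial.degree_mul]
  exact add_le_add hf hg

theorem eventually_denom_ne_zero (f : RatFunc ℝ) : ∀ᶠ x : ℝ in Filter.atTop,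
    Polynomial.eval₂ (RingHom.id ℝ) x f.denom ≠ 0 := by
  filter_upwards [Polynomial.eventually_atTop_not_isRoot f.denom f.denom_ne_zero] with x hx
  rwa [Polynomial.eval₂_id]

theorem valueAtInfty_add {f g : RatFunc ℝ} (hf : IsProper f) (hg : IsProper g) :
    valueAtInfty (f + g) = valueAtInfty f + valueAtInfty g := by
  refine tendsto_nhds_unique (tendsto_valueAtInfty (hf.add hg)) (Filter.Tendsto.congr' ?_
    ((tendsto_valueAtInfty hf).add (tendsto_valueAtInfty hg)))
  filter_upwards [eventually_denom_ne_zero f, eventually_denom_ne_zero g] with x h1 h2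
  exact (RatFunc.eval_add _ _ h1 h2).symm

theorem valueAtInfty_mul {f g : RatFunc ℝ} (hf : IsProper f) (hg : IsProper g) :
    valueAtInfty (f * g) = valueAtInfty f * valueAtInfty g := by
  refine tendsto_nhds_unique (tendsto_valueAtInfty (hf.mul hg)) (Filter.Tendsto.congr' ?_
    ((tendsto_valueAtInfty hf).mul (tendsto_valueAtInfty hg)))
  filter_upwards [eventually_denom_ne_zero f, eventually_denom_ne_zero g] with x h1 h2
  exact (RatFunc.eval_mul _ _ h1 h2).symm

/-- The ring of proper rational functions. -/
def properSubring : Subring (RatFunc ℝ) where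
  carrier := {f | IsProper f}
  mul_mem' := IsProper.mul
  one_mem' := by simpa using isProper_C 1
  add_mem' := IsProper.add
  zero_mem' := by simpa using isProper_C 0
  neg_mem' := fun {f} hf => by
    have := (isProper_C (-1)).mul hf
    simpa using this

/-- Evaluation at infinity as a ring homomorphism. -/
def properValue : properSubring →+* ℝ where
  toFun f := valueAtInfty f
  map_one' := by simpa using valueAtInfty_C 1
  map_zero' := by simpa using valueAtInfty_C 0
  map_add' f g := valueAtInfty_add f.2 g.2
  map_mul' f g := valueAtInfty_mul f.2 g.2

/-- A nonzero value at infinity means equal degrees of numerator and denominator, so the reciprocal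
is proper as well. Applied to a determinant, this allows a matrix to be inverted over the ring of
proper functions. -/
theorem isUnit_of_properValue_ne_zero {f : properSubring} (h : properValue f ≠ 0) : IsUnit f := by
  have hf : IsProper f := f.2
  have h0 : (f : RatFunc ℝ) ≠ 0 := by
    intro h0
    apply h
    have : f = 0 := Subtype.ext h0
    rw [this, map_zero]
  have hdeg : (f : RatFunc ℝ).denom.degree ≤ (f : RatFunc ℝ).num.degree := by
    by_contra hlt
    rw [not_le] at hlt
    apply h
    refine Polynomial.coeff_eq_zero_of_degree_lt ?_
    rwa [← Polynomial.degree_eq_natDegree (RatFunc.denom_ne_zero _)]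
  have hinv : IsProper (f : RatFunc ℝ)⁻¹ := by
    rw [← (f : RatFunc ℝ).num_div_denom, inv_div]
    exact isProper_div (RatFunc.num_ne_zero h0) hdeg
  exact IsUnit.of_mul_eq_one ⟨(f : RatFunc ℝ)⁻¹, hinv⟩ (Subtype.ext (mul_inv_cancel₀ h0))

variable {ι κ l : Type*}

theorem map_valueAtInfty_mul [Fintype κ] {A : Matrix ι κ (RatFunc ℝ)} {B : Matrix κ l (RatFunc ℝ)}
    (hA : ∀ i j, IsProper (A i j)) (hB : ∀ i j, IsProper (B i j)) :
    (A * B).map valueAtInfty = A.map valueAtInfty * B.map valueAtInfty := by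
  let A' : Matrix ι κ properSubring := Matrix.of fun i j => ⟨A i j, hA i j⟩
  let B' : Matrix κ l properSubring := Matrix.of fun i j => ⟨B i j, hB i j⟩
  have h1 : (A' * B').map properSubring.subtype = A * B := by
    rw [Matrix.map_mul]
    rfl
  have h2 : (A' * B').map properValue = A.map valueAtInfty * B.map valueAtInfty := by
    rw [Matrix.map_mul]
    rfl
  rw [← h1, ← h2]
  rfl

theorem isProper_mul_apply [Fintype κ] {A : Matrix ι κ (RatFunc ℝ)} {B : Matrix κ l (RatFunc ℝ)}
    (hA : ∀ i j, IsProper (A i j)) (hB : ∀ i j, IsProper (B i j)) (i : ι) (j : l) :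
    IsProper ((A * B) i j) := by
  rw [Matrix.mul_apply]
  exact sum_mem (S := properSubring) fun k _ => IsProper.mul (hA i k) (hB k j)

/-- A proper matrix that is nonsingular at infinity has a proper inverse. -/
theorem proper_inverse [Fintype ι] [DecidableEq ι] {A : Matrix ι ι (RatFunc ℝ)}
    (hA : ∀ i j, IsProper (A i j)) (hdet : (A.map valueAtInfty).det ≠ 0) :
    A.det ≠ 0 ∧ (∀ i j, IsProper (A⁻¹ i j)) ∧
      A⁻¹.map valueAtInfty = (A.map valueAtInfty)⁻¹ := by
  let A' : Matrix ι ι properSubring := Matrix.of fun i j => ⟨A i j, hA i j⟩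
  have h1 : A'.map properSubring.subtype = A := rfl
  have h2 : A'.map properValue = A.map valueAtInfty := rfl
  have hu : IsUnit A'.det := by
    apply isUnit_of_properValue_ne_zero
    have := RingHom.map_det properValue A'
    rw [RingHom.mapMatrix_apply, h2] at this
    rwa [this]
  have h3 : A * A'⁻¹.map properSubring.subtype = 1 := by
    conv_lhs => rw [← h1]
    rw [← Matrix.map_mul, Matrix.mul_nonsing_inv _ hu]
    simp
  have h4 : A.map valueAtInfty * A'⁻¹.map properValue = 1 := by
    rw [← h2, ← Matrix.map_mul, Matrix.mul_nonsing_inv _ hu]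
    simp
  have h5 : A⁻¹ = A'⁻¹.map properSubring.subtype := Matrix.inv_eq_right_inv h3
  refine ⟨?_, ?_, ?_⟩
  · intro h0
    have := congrArg Matrix.det h3
    rw [Matrix.det_mul, h0, zero_mul, Matrix.det_one] at this
    exact zero_ne_one this
  · intro i j
    rw [h5]
    exact (A'⁻¹ i j).2
  · rw [h5, Matrix.inv_eq_right_inv h4]
    rfl

end Proper

/-! ### Rational functions without poles in a given set -/

section Regular

/-- The ring of rational functions without poles in `D`. -/
def regularSubring (D : Set ℂ) : Subring (RatFunc ℝ) where
  carrier := {f | ∀ z ∈ D, Polynomial.aeval z f.denom ≠ 0}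
  mul_mem' := by
    intro f g hf hg z hz h0
    have := Polynomial.eval₂_eq_zero_of_dvd_of_eval₂_eq_zero (algebraMap ℝ ℂ) z
      (RatFunc.denom_mul_dvd f g) h0
    rw [Polynomial.eval₂_mul] at this
    exact (mul_ne_zero (hf z hz) (hg z hz)) this
  one_mem' := by simp
  add_mem' := by
    intro f g hf hg z hz h0
    have := Polynomial.eval₂_eq_zero_of_dvd_of_eval₂_eq_zero (algebraMap ℝ ℂ) z
      (RatFunc.denom_add_dvd f g) h0
    rw [Polynomial.eval₂_mul] at this
    exact (mul_ne_zero (hf z hz) (hg z hz)) this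
  zero_mem' := by simp
  neg_mem' := by
    intro f hf z hz h0
    have h1 : f.denom ∣ (-f).denom ∧ (-f).denom ∣ f.denom := by
      have key : ∀ g : RatFunc ℝ, (-g).denom ∣ g.denom := fun g => by
        have h2 : -g = algebraMap (Polynomial ℝ) (RatFunc ℝ) (-g.num) /
            algebraMap (Polynomial ℝ) (RatFunc ℝ) g.denom := by
          rw [map_neg, neg_div, g.num_div_denom]
        rw [h2]
        exact RatFunc.denom_div_dvd _ _
      exact ⟨by simpa using key (-f), key f⟩
    exact hf z hz (Polynomial.eval₂_eq_zero_of_dvd_of_eval₂_eq_zero (algebraMap ℝ ℂ) z h1.2 h0)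

theorem mem_regularSubring {D : Set ℂ} {f : RatFunc ℝ} :
    f ∈ regularSubring D ↔ ∀ z ∈ D, Polynomial.aeval z f.denom ≠ 0 := Iff.rfl

theorem C_mem_regularSubring (D : Set ℂ) (c : ℝ) : RatFunc.C c ∈ regularSubring D := by
  simp [mem_regularSubring, RatFunc.denom_C]

/-- Evaluation at a point as a ring homomorphism on the rational functions regular there. -/
def regularEval (z : ℂ) : regularSubring {z} →+* ℂ where
  toFun f := evalAt z f
  map_one' := by simp [evalAt]
  map_zero' := by simp [evalAt]
  map_add' f g := RatFunc.eval_add _ _ (f.2 z rfl) (g.2 z rfl)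
  map_mul' f g := RatFunc.eval_mul _ _ (f.2 z rfl) (g.2 z rfl)

variable {ι κ l : Type*}

theorem map_evalAt_mul [Fintype κ] {A : Matrix ι κ (RatFunc ℝ)} {B : Matrix κ l (RatFunc ℝ)}
    {z : ℂ} (hA : ∀ i j, A i j ∈ regularSubring {z}) (hB : ∀ i j, B i j ∈ regularSubring {z}) :
    (A * B).map (evalAt z) = A.map (evalAt z) * B.map (evalAt z) := by
  let A' : Matrix ι κ (regularSubring {z}) := Matrix.of fun i j => ⟨A i j, hA i j⟩
  let B' : Matrix κ l (regularSubring {z}) := Matrix.of fun i j => ⟨B i j, hB i j⟩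
  have h1 : (A' * B').map (regularSubring {z}).subtype = A * B := by
    rw [Matrix.map_mul]
    rfl
  have h2 : (A' * B').map (regularEval z) = A.map (evalAt z) * B.map (evalAt z) := by
    rw [Matrix.map_mul]
    rfl
  rw [← h1, ← h2]
  rfl

theorem mul_apply_mem_regularSubring [Fintype κ] {D : Set ℂ} {A : Matrix ι κ (RatFunc ℝ)}
    {B : Matrix κ l (RatFunc ℝ)} (hA : ∀ i j, A i j ∈ regularSubring D)
    (hB : ∀ i j, B i j ∈ regularSubring D) (i : ι) (j : l) : (A * B) i j ∈ regularSubring D := by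
  rw [Matrix.mul_apply]
  exact sum_mem fun k _ => mul_mem (hA i k) (hB k j)

end Regular

/-- Jacobi's complementary minor criterion for principal minors. -/
theorem det_inv_submatrix_ne_zero {V F : Type*} [Field F] [Fintype V] [DecidableEq V]
    {A : Matrix V V F} (hA : A.det ≠ 0) (S : Finset V)
    (hS : (A.submatrix (fun s : (Sᶜ : Finset V) => (s : V))
      (fun s : (Sᶜ : Finset V) => (s : V))).det ≠ 0) :
    (A⁻¹.submatrix (fun s : S => (s : V)) (fun s : S => (s : V))).det ≠ 0 := by
  intro h0
  obtain ⟨v, hv, hv0⟩ := Matrix.exists_mulVec_eq_zero_iff.mpr h0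
  -- Extend a kernel vector of the `S`-block of `A⁻¹` by zero. Then `y = A⁻¹ x` vanishes on `S` and
  -- `A y = x` vanishes off `S`, so the rest of `y` is in the kernel of the complementary block of
  -- `A`.
  let x : V → F := fun i => if h : i ∈ S then v ⟨i, h⟩ else 0
  have hxS : ∀ s : S, x s = v s := fun s => by simp [x]
  have hx0 : ∀ i, i ∉ S → x i = 0 := fun i hi => by simp [x, hi]
  let y : V → F := A⁻¹ *ᵥ x
  have hAy : A *ᵥ y = x := by
    simp only [y, Matrix.mulVec_mulVec]
    rw [Matrix.mul_nonsing_inv _ hA.isUnit, Matrix.one_mulVec]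
  have hsumS : ∀ f : V → F, (∀ i, i ∉ S → f i = 0) → ∑ i, f i = ∑ s : S, f s := by
    intro f hf
    rw [Finset.sum_coe_sort S f]
    exact (Finset.sum_subset (Finset.subset_univ S) fun i _ hi => hf i hi).symm
  have hyS : ∀ i ∈ S, y i = 0 := by
    intro i hi
    have h1 := congrFun hv0 ⟨i, hi⟩
    simp only [Matrix.mulVec, dotProduct, Matrix.submatrix_apply, Pi.zero_apply] at h1
    simp only [y, Matrix.mulVec, dotProduct]
    rw [hsumS _ (fun k hk => by rw [hx0 k hk, mul_zero]), ← h1]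
    exact Finset.sum_congr rfl fun s _ => by rw [hxS]
  have hyc : (fun s : (Sᶜ : Finset V) => y s) = 0 := by
    by_contra hne
    refine hS (Matrix.exists_mulVec_eq_zero_iff.mp ⟨_, hne, ?_⟩)
    funext s
    have h1 := congrFun hAy s
    rw [hx0 s (Finset.mem_compl.mp s.2)] at h1
    rw [Pi.zero_apply, ← h1]
    simp only [Matrix.mulVec, dotProduct, Matrix.submatrix_apply]
    rw [Finset.sum_coe_sort Sᶜ (fun k => A s k * y k)]
    refine Finset.sum_subset (Finset.subset_univ _) fun i _ hi => ?_
    rw [Finset.mem_compl, not_not] at hi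
    rw [hyS i hi, mul_zero]
  have hy : y = 0 := by
    funext i
    by_cases hi : i ∈ S
    · exact hyS i hi
    · exact congrFun hyc ⟨i, Finset.mem_compl.mpr hi⟩
  apply hv
  funext s
  rw [← hxS, ← hAy, hy, Matrix.mulVec_zero]
  rfl

/-! ### Rational functions on the unit circle -/

section UnitCircle

/-- The point of the unit circle at frequency `ω`. -/
def circlePoint (ω : ℝ) : ℂ := Complex.exp (Complex.I * ω)

theorem norm_circlePoint (ω : ℝ) : ‖circlePoint ω‖ = 1 := by
  rw [circlePoint, mul_comm]
  exact Complex.norm_exp_ofReal_mul_I ω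

theorem circlePoint_ne_zero (ω : ℝ) : circlePoint ω ≠ 0 := Complex.exp_ne_zero _

theorem conj_circlePoint (ω : ℝ) : (starRingEnd ℂ) (circlePoint ω) = (circlePoint ω)⁻¹ :=
  (Complex.inv_eq_conj (norm_circlePoint ω)).symm

theorem continuous_circlePoint : Continuous circlePoint := by
  unfold circlePoint
  fun_prop

theorem exists_circlePoint_eq {z : ℂ} (hz : ‖z‖ = 1) : ∃ ω : ℝ, circlePoint ω = z := by
  obtain ⟨ω, hω⟩ := (Complex.norm_eq_one_iff z).mp hz
  exact ⟨ω, by rw [circlePoint, mul_comm, hω]⟩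

theorem countable_preimage_circlePoint (F : Set ℂ) (hF : F.Finite) :
    (circlePoint ⁻¹' F).Countable := by
  rw [← Set.biUnion_preimage_singleton]
  refine hF.countable.biUnion fun z _ => ?_
  rcases (circlePoint ⁻¹' {z}).eq_empty_or_nonempty with h | ⟨ω₀, hω₀⟩
  · rw [h]
    exact Set.countable_empty
  · refine (Set.countable_range fun k : ℤ => ω₀ + k * (2 * Real.pi)).mono fun ω hω => ?_
    have h : Complex.exp (Complex.I * ω) = Complex.exp (Complex.I * ω₀) := by
      have h1 : circlePoint ω = z := hω
      have h2 : circlePoint ω₀ = z := hω₀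
      exact h1.trans h2.symm
    obtain ⟨k, hk⟩ := Complex.exp_eq_exp_iff_exists_int.mp h
    refine ⟨k, ?_⟩
    have h3 : Complex.I * (ω : ℂ) = Complex.I * ((ω₀ + k * (2 * Real.pi) : ℝ) : ℂ) := by
      rw [hk]
      push_cast
      ring
    have h4 := mul_left_cancel₀ Complex.I_ne_zero h3
    exact_mod_cast h4.symm

theorem countable_roots_circlePoint {p : Polynomial ℝ} (hp : p ≠ 0) :
    {ω : ℝ | Polynomial.aeval (circlePoint ω) p = 0}.Countable := by
  have hmap : p.map (algebraMap ℝ ℂ) ≠ 0 :=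
    (Polynomial.map_ne_zero_iff (algebraMap ℝ ℂ).injective).mpr hp
  refine (countable_preimage_circlePoint _ (Polynomial.finite_setOfPred_isRoot hmap)).mono
    fun ω hω => ?_
  have hω' : Polynomial.aeval (circlePoint ω) p = 0 := hω
  change (p.map (algebraMap ℝ ℂ)).eval (circlePoint ω) = 0
  rwa [Polynomial.eval_map_algebraMap]

/-- A nonzero polynomial vanishes at only countably many frequencies, whereas the real line is
uncountable. -/
theorem eq_zero_of_dense_roots {p : Polynomial ℝ} {D : Set ℝ} (hD : Dᶜ.Countable)
    (h : ∀ ω ∈ D, Polynomial.aeval (circlePoint ω) p = 0) : p = 0 := by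
  by_contra hp
  have h1 : (Set.univ : Set ℝ).Countable := by
    refine (hD.union (countable_roots_circlePoint hp)).mono fun ω _ => ?_
    by_cases hω : ω ∈ D
    · exact Or.inr (h ω hω)
    · exact Or.inl hω
  exact Set.not_countable_univ h1

theorem aeval_conj_real (p : Polynomial ℝ) (z : ℂ) :
    (starRingEnd ℂ) (Polynomial.aeval z p) = Polynomial.aeval ((starRingEnd ℂ) z) p :=
  (Polynomial.aeval_conj p z).symm

theorem evalAt_eq_div (z : ℂ) (f : RatFunc ℝ) :
    evalAt z f = Polynomial.aeval z f.num / Polynomial.aeval z f.denom := rfl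

theorem aeval_num_ne_zero_of_denom_eq_zero {f : RatFunc ℝ} {z : ℂ}
    (h : Polynomial.aeval z f.denom = 0) : Polynomial.aeval z f.num ≠ 0 := by
  intro h0
  obtain ⟨a, b, hab⟩ := f.isCoprime_num_denom
  have := congrArg (Polynomial.aeval z) hab
  rw [map_add, map_mul, map_mul, h, h0, mul_zero, mul_zero, add_zero, map_one] at this
  exact zero_ne_one this

/-- A rational function that is bounded on almost all of the unit circle has no pole there. -/
theorem aeval_denom_ne_zero_of_bounded {f : RatFunc ℝ} {D : Set ℝ} (hD : Dᶜ.Countable)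
    (h : ∀ ω ∈ D, ‖evalAt (circlePoint ω) f‖ ≤ 1) {z : ℂ} (hz : ‖z‖ = 1) :
    Polynomial.aeval z f.denom ≠ 0 := by
  obtain ⟨ω₀, rfl⟩ := exists_circlePoint_eq hz
  intro h0
  -- Free of division, the bound is a closed condition and passes from a dense set to the supposed
  -- pole. There the numerator would vanish along with the denominator, against coprimality.
  have hclosed : IsClosed {ω : ℝ | ‖Polynomial.aeval (circlePoint ω) f.num‖ ≤
      ‖Polynomial.aeval (circlePoint ω) f.denom‖} := by
    have hc := continuous_circlePoint
    exact isClosed_le ((Polynomial.continuous_aeval _).comp hc).norm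
      ((Polynomial.continuous_aeval _).comp hc).norm
  have hdense : Dense (Dᶜ ∪ {ω : ℝ | Polynomial.aeval (circlePoint ω) f.denom = 0})ᶜ :=
    (hD.union (countable_roots_circlePoint f.denom_ne_zero)).dense_compl ℝ
  have hsub : (Dᶜ ∪ {ω : ℝ | Polynomial.aeval (circlePoint ω) f.denom = 0})ᶜ ⊆
      {ω : ℝ | ‖Polynomial.aeval (circlePoint ω) f.num‖ ≤
        ‖Polynomial.aeval (circlePoint ω) f.denom‖} := by
    intro ω hω
    rw [Set.compl_union, compl_compl] at hω
    have h1 := h ω hω.1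
    have h2 : Polynomial.aeval (circlePoint ω) f.denom ≠ 0 := hω.2
    rw [evalAt_eq_div, norm_div, div_le_one (norm_pos_iff.mpr h2)] at h1
    exact h1
  have h3 : ω₀ ∈ closure (Dᶜ ∪ {ω : ℝ | Polynomial.aeval (circlePoint ω) f.denom = 0})ᶜ :=
    hdense ω₀
  have h4 : ‖Polynomial.aeval (circlePoint ω₀) f.num‖ ≤
    ‖Polynomial.aeval (circlePoint ω₀) f.denom‖ := hclosed.closure_subset_iff.mpr hsub h3
  rw [h0, norm_zero, norm_le_zero_iff] at h4
  exact aeval_num_ne_zero_of_denom_eq_zero h0 h4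

/-- Reflection is the substitution `z ↦ z⁻¹` with denominators cleared. On the unit circle this
substitution is complex conjugation, so it expresses conjugates of values of real polynomials. -/
theorem aeval_reflect {p : Polynomial ℝ} {N : ℕ} (hp : p.natDegree ≤ N) {z : ℂ} (hz : z ≠ 0) :
    Polynomial.aeval z (p.reflect N) = z ^ N * Polynomial.aeval z⁻¹ p := by
  let _ : Invertible z⁻¹ := invertibleOfNonzero (inv_ne_zero hz)
  have h := Polynomial.eval₂_reflect_mul_pow (algebraMap ℝ ℂ) z⁻¹ N p hp
  rw [invOf_eq_inv, inv_inv] at h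
  rw [Polynomial.aeval_def, Polynomial.aeval_def, ← h, mul_comm, mul_assoc, ← mul_pow,
    inv_mul_cancel₀ hz, one_pow, mul_one]

/-- A proper rational function that has no poles in `|z| ≥ 1`, whose para-conjugate has the same
properties, is constant. -/
theorem exists_eq_C_of_paraconjugate {f g : RatFunc ℝ} (hf : IsProper f) (hg : IsProper g)
    (hfr : f ∈ regularSubring {z | 1 < ‖z‖}) (hgr : g ∈ regularSubring {z | 1 < ‖z‖})
    {D : Set ℝ} (hD : Dᶜ.Countable) (hfb : ∀ ω ∈ D, ‖evalAt (circlePoint ω) f‖ ≤ 1)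
    (hgb : ∀ ω ∈ D, ‖evalAt (circlePoint ω) g‖ ≤ 1)
    (hfg : ∀ ω ∈ D, (starRingEnd ℂ) (evalAt (circlePoint ω) f) = evalAt (circlePoint ω) g) :
    ∃ c : ℝ, f = RatFunc.C c := by
  have hfc : ∀ z : ℂ, 1 ≤ ‖z‖ → Polynomial.aeval z f.denom ≠ 0 := fun z hz =>
    hz.eq_or_lt.elim (fun h => aeval_denom_ne_zero_of_bounded hD hfb h.symm) (hfr z)
  have hgc : ∀ z : ℂ, 1 ≤ ‖z‖ → Polynomial.aeval z g.denom ≠ 0 := fun z hz =>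
    hz.eq_or_lt.elim (fun h => aeval_denom_ne_zero_of_bounded hD hgb h.symm) (hgr z)
  by_cases hf0 : f = 0
  · exact ⟨0, by simp [hf0]⟩
  have hn0 : f.num ≠ 0 := RatFunc.num_ne_zero hf0
  set N := f.denom.natDegree with hN
  have hnN : f.num.natDegree ≤ N := Polynomial.natDegree_le_natDegree hf
  -- This is `g(z) = f(1/z)` cleared of denominators, true on the circle and hence as polynomials. A
  -- pole of `f` in the open disc becomes a pole of `g` outside it or at infinity.
  have hid : g.num * f.denom.reflect N = f.num.reflect N * g.denom := by
    rw [← sub_eq_zero]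
    refine eq_zero_of_dense_roots hD fun ω hω => ?_
    have h1 := hfg ω hω
    have hz := circlePoint_ne_zero ω
    have hd := hfc (circlePoint ω)⁻¹ (by rw [norm_inv, norm_circlePoint, inv_one])
    have he := hgc (circlePoint ω) (norm_circlePoint ω).ge
    rw [evalAt_eq_div, evalAt_eq_div, map_div₀, aeval_conj_real, aeval_conj_real,
      conj_circlePoint, div_eq_div_iff hd he] at h1
    rw [map_sub, map_mul, map_mul, aeval_reflect le_rfl hz, aeval_reflect hnN hz, sub_eq_zero]
    linear_combination (-(circlePoint ω) ^ N) * h1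
  have hg0 : g.num * f.denom.reflect N ≠ 0 := by
    rw [hid]
    exact mul_ne_zero (by rwa [Ne, Polynomial.reflect_eq_zero_iff]) g.denom_ne_zero
  have hnoroot : ∀ z : ℂ, Polynomial.aeval z f.denom ≠ 0 := by
    intro z hz
    have hnz := aeval_num_ne_zero_of_denom_eq_zero hz
    by_cases hz0 : z = 0
    · subst hz0
      have hd0 : f.denom.coeff 0 = 0 := by
        rw [Polynomial.aeval_def, Polynomial.eval₂_at_zero] at hz
        simpa using hz
      have hc0 : f.num.coeff 0 ≠ 0 := by
        rw [Polynomial.aeval_def, Polynomial.eval₂_at_zero] at hnz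
        simpa using hnz
      -- A pole of `f` at `0` lowers the degree of the reflected denominator but not that of the
      -- reflected numerator, so `g` would not be proper.
      have h1 : (f.denom.reflect N).natDegree < N := by
        have hle : (f.denom.reflect N).natDegree ≤ N := by
          exact Polynomial.natDegree_reflect_le.trans (max_le le_rfl hN.ge)
        refine lt_of_le_of_ne hle fun heq => right_ne_zero_of_mul hg0 ?_
        rw [← Polynomial.leadingCoeff_eq_zero, Polynomial.leadingCoeff, heq,
          Polynomial.coeff_reflect, Polynomial.revAt_le le_rfl, Nat.sub_self, hd0]
      have h2 : N ≤ (f.num.reflect N).natDegree := by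
        refine Polynomial.le_natDegree_of_ne_zero ?_
        rwa [Polynomial.coeff_reflect, Polynomial.revAt_le le_rfl, Nat.sub_self]
      have h3 := congrArg Polynomial.natDegree hid
      rw [Polynomial.natDegree_mul (left_ne_zero_of_mul hg0) (right_ne_zero_of_mul hg0),
        Polynomial.natDegree_mul (left_ne_zero_of_mul (hid ▸ hg0)) g.denom_ne_zero] at h3
      have h4 : g.num.natDegree ≤ g.denom.natDegree := Polynomial.natDegree_le_natDegree hg
      omega
    · have hlt : ‖z‖ < 1 := by
        by_contra hge
        exact hfc z (not_lt.mp hge) hz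
      have h1 := congrArg (Polynomial.aeval z⁻¹) hid
      rw [map_mul, map_mul, aeval_reflect le_rfl (inv_ne_zero hz0),
        aeval_reflect hnN (inv_ne_zero hz0), inv_inv, hz, mul_zero, mul_zero] at h1
      refine mul_ne_zero (mul_ne_zero (pow_ne_zero _ (inv_ne_zero hz0)) hnz) ?_ h1.symm
      refine hgc z⁻¹ ?_
      rw [norm_inv]
      exact (one_le_inv₀ (norm_pos_iff.mpr hz0)).mpr hlt.le
  have hN0 : f.denom.degree = 0 := by
    by_contra hne
    obtain ⟨z, hz⟩ := Complex.exists_root (f := f.denom.map (algebraMap ℝ ℂ)) (by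
      rw [Polynomial.degree_map, Polynomial.degree_eq_natDegree f.denom_ne_zero]
      rw [Polynomial.degree_eq_natDegree f.denom_ne_zero] at hne
      exact_mod_cast Nat.pos_of_ne_zero (by exact_mod_cast hne))
    refine hnoroot z ?_
    rw [← Polynomial.eval_map_algebraMap]
    exact hz
  have hd1 : f.denom = 1 := f.monic_denom.eq_one_of_isUnit (by
    rw [Polynomial.isUnit_iff_degree_eq_zero]
    exact hN0)
  have hnC : f.num = Polynomial.C (f.num.coeff 0) :=
    Polynomial.eq_C_of_degree_le_zero (hN0 ▸ hf)
  refine ⟨f.num.coeff 0, ?_⟩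
  conv_lhs => rw [← f.num_div_denom, hd1, hnC]
  simp

end UnitCircle

/-! ### Uniqueness of spectral factors -/

section SpectralFactorization

variable {ι : Type*}

open scoped MatrixOrder Matrix.Norms.L2Operator in
theorem exists_real_factor [Fintype ι] [DecidableEq ι] {L : Matrix ι ι ℝ} (hL : L.PosSemidef) (hdet : L.det ≠ 0) :
    ∃ B : Matrix ι ι ℝ, B.det ≠ 0 ∧ L = B * Bᵀ := by
  obtain ⟨B, hB⟩ : ∃ B : Matrix ι ι ℝ, L = Bᴴ * B :=
    CStarAlgebra.nonneg_iff_eq_star_mul_self.mp hL.nonneg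
  rw [Matrix.conjTranspose_eq_transpose_of_trivial] at hB
  refine ⟨Bᵀ, fun h0 => hdet ?_, by rw [Matrix.transpose_transpose, hB]⟩
  rw [hB, Matrix.det_mul, h0, zero_mul]

theorem map_C_map_evalAt (z : ℂ) (L : Matrix ι ι ℝ) :
    (L.map RatFunc.C).map (evalAt z) = L.map (algebraMap ℝ ℂ) := by
  ext i j
  simp [evalAt]

theorem map_C_mul [Fintype ι] (L L' : Matrix ι ι ℝ) :
    L.map RatFunc.C * L'.map RatFunc.C = (L * L').map RatFunc.C :=
  (Matrix.map_mul).symm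

theorem conjTranspose_map_real (L : Matrix ι ι ℝ) :
    (L.map (algebraMap ℝ ℂ))ᴴ = Lᵀ.map (algebraMap ℝ ℂ) := by
  ext i j
  simp

variable [Fintype ι] [DecidableEq ι]

/-- Uniqueness of stable, minimum-phase, biproper spectral factors up to a constant matrix. -/
theorem spectralFactor_unique {A₀ A₁ : Matrix ι ι (RatFunc ℝ)} {Λ₀ Λ₁ : Matrix ι ι ℝ}
    (hs₀ : ∀ i j, IsStable (A₀ i j)) (hs₁ : ∀ i j, IsStable (A₁ i j))
    (hp₀ : ∀ i j, IsProper (A₀ i j)) (hp₁ : ∀ i j, IsProper (A₁ i j))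
    (hm₀ : IsMinimumPhase A₀) (hm₁ : IsMinimumPhase A₁)
    (hi₀ : (A₀.map valueAtInfty).det ≠ 0) (hi₁ : (A₁.map valueAtInfty).det ≠ 0)
    (hΛ₀ : Λ₀.PosSemidef) (hΛ₁ : Λ₁.PosSemidef) (hd₀ : Λ₀.det ≠ 0) (hd₁ : Λ₁.det ≠ 0)
    (h : ∀ ω : ℝ, A₀.map (evalAt (circlePoint ω)) * Λ₀.map (algebraMap ℝ ℂ) *
        (A₀.map (evalAt (circlePoint ω)))ᴴ =
      A₁.map (evalAt (circlePoint ω)) * Λ₁.map (algebraMap ℝ ℂ) *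
        (A₁.map (evalAt (circlePoint ω)))ᴴ) :
    ∃ U : Matrix ι ι ℝ, A₀ = A₁ * U.map RatFunc.C ∧ U * Λ₀ * Uᵀ = Λ₁ := by
  obtain ⟨L₀, hL₀, rfl⟩ := exists_real_factor hΛ₀ hd₀
  obtain ⟨L₁, hL₁, rfl⟩ := exists_real_factor hΛ₁ hd₁
  obtain ⟨hA₀, hr₀⟩ := hm₀
  obtain ⟨hA₁, hr₁⟩ := hm₁
  have hip₀ := (proper_inverse hp₀ hi₀).2.1
  have hip₁ := (proper_inverse hp₁ hi₁).2.1
  have hCC : ∀ L : Matrix ι ι ℝ, L.det ≠ 0 → L.map RatFunc.C * L⁻¹.map RatFunc.C = 1 := by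
    intro L hL
    rw [map_C_mul, Matrix.mul_nonsing_inv _ hL.isUnit]
    simp
  have hCC' : ∀ L : Matrix ι ι ℝ, L.det ≠ 0 → L⁻¹.map RatFunc.C * L.map RatFunc.C = 1 := by
    intro L hL
    rw [map_C_mul, Matrix.nonsing_inv_mul _ hL.isUnit]
    simp
  have hinv : ∀ (A : Matrix ι ι (RatFunc ℝ)) (L : Matrix ι ι ℝ), A.det ≠ 0 → L.det ≠ 0 →
      (A * L.map RatFunc.C) * (L⁻¹.map RatFunc.C * A⁻¹) = 1 := by
    intro A L hA hL
    rw [Matrix.mul_assoc, ← Matrix.mul_assoc (L.map _), hCC L hL, Matrix.one_mul,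
      Matrix.mul_nonsing_inv _ hA.isUnit]
  -- `B₀` and `B₁` are factors normalized to identity covariance, `N₀` and `N₁` their inverses. The
  -- quotient `N₁ * B₀` will be unitary on the circle, with inverse `N₀ * B₁`.
  set B₀ := A₀ * L₀.map RatFunc.C with hB₀
  set B₁ := A₁ * L₁.map RatFunc.C with hB₁
  set N₀ := L₀⁻¹.map RatFunc.C * A₀⁻¹ with hN₀
  set N₁ := L₁⁻¹.map RatFunc.C * A₁⁻¹ with hN₁
  have hBN₀ : B₀ * N₀ = 1 := hinv A₀ L₀ hA₀ hL₀
  have hBN₁ : B₁ * N₁ = 1 := hinv A₁ L₁ hA₁ hL₁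
  have hCreg : ∀ (L : Matrix ι ι ℝ) (D : Set ℂ) i j, L.map RatFunc.C i j ∈ regularSubring D :=
    fun L D i j => C_mem_regularSubring D _
  have hCprop : ∀ (L : Matrix ι ι ℝ) i j, IsProper (L.map RatFunc.C i j) :=
    fun L i j => isProper_C _
  have hBreg : ∀ (A : Matrix ι ι (RatFunc ℝ)) (L : Matrix ι ι ℝ) (D : Set ℂ),
      (∀ i j, A i j ∈ regularSubring D) → ∀ i j, (A * L.map RatFunc.C) i j ∈ regularSubring D :=
    fun A L D hA => mul_apply_mem_regularSubring hA (hCreg L D)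
  have hNreg : ∀ (A : Matrix ι ι (RatFunc ℝ)) (L : Matrix ι ι ℝ) (D : Set ℂ),
      (∀ i j, A i j ∈ regularSubring D) → ∀ i j, (L.map RatFunc.C * A) i j ∈ regularSubring D :=
    fun A L D hA => mul_apply_mem_regularSubring (hCreg L D) hA
  have hstab : ∀ {A : Matrix ι ι (RatFunc ℝ)} {D : Set ℂ}, (∀ i j, IsStable (A i j)) →
      (∀ z ∈ D, 1 ≤ ‖z‖) → ∀ i j, A i j ∈ regularSubring D :=
    fun hA hD i j z hz => hA i j z (hD z hz)
  have hout : ∀ z ∈ {z : ℂ | 1 < ‖z‖}, 1 ≤ ‖z‖ := fun z hz => le_of_lt hz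
  -- Minimum phase allows zeros on the circle, where the inverses then have poles; these countably
  -- many frequencies are left out.
  let D : Set ℝ := {ω | ∀ i j, Polynomial.aeval (circlePoint ω) (A₀⁻¹ i j).denom ≠ 0 ∧
    Polynomial.aeval (circlePoint ω) (A₁⁻¹ i j).denom ≠ 0}
  have hD : Dᶜ.Countable := by
    have h1 : Dᶜ ⊆ ⋃ i, ⋃ j, ({ω | Polynomial.aeval (circlePoint ω) (A₀⁻¹ i j).denom = 0} ∪
        {ω | Polynomial.aeval (circlePoint ω) (A₁⁻¹ i j).denom = 0}) := by
      intro ω hω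
      by_contra hcon
      apply hω
      intro i j
      simp only [Set.mem_iUnion, not_exists] at hcon
      exact ⟨fun h0 => hcon i j (Or.inl h0), fun h0 => hcon i j (Or.inr h0)⟩
    refine Set.Countable.mono h1 ?_
    exact Set.countable_iUnion fun i => Set.countable_iUnion fun j =>
      (countable_roots_circlePoint (RatFunc.denom_ne_zero _)).union
        (countable_roots_circlePoint (RatFunc.denom_ne_zero _))
  have hunit : ∀ ω ∈ D, (N₁ * B₀).map (evalAt (circlePoint ω)) *
      ((N₁ * B₀).map (evalAt (circlePoint ω)))ᴴ = 1 ∧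
      (N₀ * B₁).map (evalAt (circlePoint ω)) = ((N₁ * B₀).map (evalAt (circlePoint ω)))ᴴ := by
    intro ω hω
    set z := circlePoint ω with hz
    have hcirc : ∀ w ∈ ({z} : Set ℂ), 1 ≤ ‖w‖ := by
      rintro w rfl
      exact (norm_circlePoint ω).ge
    have hA₀z := hstab hs₀ hcirc
    have hA₁z := hstab hs₁ hcirc
    have hI₀z : ∀ i j, A₀⁻¹ i j ∈ regularSubring {z} := by
      rintro i j w rfl
      exact (hω i j).1
    have hI₁z : ∀ i j, A₁⁻¹ i j ∈ regularSubring {z} := by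
      rintro i j w rfl
      exact (hω i j).2
    have hB₀z := hBreg A₀ L₀ {z} hA₀z
    have hB₁z := hBreg A₁ L₁ {z} hA₁z
    have hN₀z := hNreg A₀⁻¹ L₀⁻¹ {z} hI₀z
    have hN₁z := hNreg A₁⁻¹ L₁⁻¹ {z} hI₁z
    have hone : (1 : Matrix ι ι (RatFunc ℝ)).map (evalAt z) = 1 := by
      ext i j
      by_cases hij : i = j <;> simp [Matrix.one_apply, hij, evalAt]
    rw [map_evalAt_mul hN₁z hB₀z, map_evalAt_mul hN₀z hB₁z]
    have e₀ : B₀.map (evalAt z) * N₀.map (evalAt z) = 1 := by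
      rw [← map_evalAt_mul hB₀z hN₀z, hBN₀, hone]
    have e₁ : B₁.map (evalAt z) * N₁.map (evalAt z) = 1 := by
      rw [← map_evalAt_mul hB₁z hN₁z, hBN₁, hone]
    have hgram : ∀ (A : Matrix ι ι (RatFunc ℝ)) (L : Matrix ι ι ℝ),
        (∀ i j, A i j ∈ regularSubring {z}) →
        (A * L.map RatFunc.C).map (evalAt z) * ((A * L.map RatFunc.C).map (evalAt z))ᴴ =
        A.map (evalAt z) * (L * Lᵀ).map (algebraMap ℝ ℂ) * (A.map (evalAt z))ᴴ := by
      intro A L hA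
      rw [map_evalAt_mul hA (hCreg L _), map_C_map_evalAt, Matrix.conjTranspose_mul,
        conjTranspose_map_real, Matrix.map_mul]
      simp only [Matrix.mul_assoc]
    have hg : B₀.map (evalAt z) * (B₀.map (evalAt z))ᴴ =
        B₁.map (evalAt z) * (B₁.map (evalAt z))ᴴ := by
      rw [hB₀, hB₁, hgram A₀ L₀ hA₀z, hgram A₁ L₁ hA₁z]
      exact h ω
    generalize B₀.map (evalAt z) = b₀ at *
    generalize B₁.map (evalAt z) = b₁ at *
    generalize N₀.map (evalAt z) = n₀ at *
    generalize N₁.map (evalAt z) = n₁ at *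
    have e₀' : n₀ * b₀ = 1 := mul_eq_one_comm.mp e₀
    have e₁' : n₁ * b₁ = 1 := mul_eq_one_comm.mp e₁
    have hQ : n₁ * b₀ * (n₁ * b₀)ᴴ = 1 := by
      calc n₁ * b₀ * (n₁ * b₀)ᴴ = n₁ * (b₀ * b₀ᴴ) * n₁ᴴ := by
            rw [Matrix.conjTranspose_mul]
            simp only [Matrix.mul_assoc]
        _ = (n₁ * b₁) * (n₁ * b₁)ᴴ := by
            rw [hg, Matrix.conjTranspose_mul]
            simp only [Matrix.mul_assoc]
        _ = 1 := by rw [e₁']; simp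
    refine ⟨hQ, ?_⟩
    calc n₀ * b₁ = n₀ * b₁ * (n₁ * b₀ * (n₁ * b₀)ᴴ) := by rw [hQ, Matrix.mul_one]
      _ = n₀ * (b₁ * n₁) * b₀ * (n₁ * b₀)ᴴ := by simp only [Matrix.mul_assoc]
      _ = (n₁ * b₀)ᴴ := by rw [e₁, Matrix.mul_one, e₀', Matrix.one_mul]
  -- Entries of a unitary matrix have modulus at most one, and conjugation takes entry `(a, b)` of
  -- `N₁ * B₀` to entry `(b, a)` of its inverse. Both are proper and regular outside the closed
  -- disc, so nothing but constants remains.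
  have hconst : ∀ a b, ∃ c : ℝ, (N₁ * B₀) a b = RatFunc.C c := by
    intro a b
    have hnorm : ∀ ω ∈ D, ‖evalAt (circlePoint ω) ((N₁ * B₀) a b)‖ ≤ 1 := fun ω hω =>
      entry_norm_bound_of_unitary (U := (N₁ * B₀).map (evalAt (circlePoint ω)))
        (Matrix.mem_unitaryGroup_iff.mpr (hunit ω hω).1) a b
    have hconj : ∀ ω ∈ D, (starRingEnd ℂ) (evalAt (circlePoint ω) ((N₁ * B₀) a b)) =
        evalAt (circlePoint ω) ((N₀ * B₁) b a) := fun ω hω =>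
      (congrFun (congrFun (hunit ω hω).2 b) a).symm
    refine exists_eq_C_of_paraconjugate (g := (N₀ * B₁) b a) ?_ ?_ ?_ ?_ hD hnorm ?_ hconj
    · exact isProper_mul_apply (isProper_mul_apply (hCprop _) hip₁)
        (isProper_mul_apply hp₀ (hCprop _)) a b
    · exact isProper_mul_apply (isProper_mul_apply (hCprop _) hip₀)
        (isProper_mul_apply hp₁ (hCprop _)) b a
    · exact mul_apply_mem_regularSubring (hNreg _ _ _ hr₁) (hBreg _ _ _ (hstab hs₀ hout)) a b
    · exact mul_apply_mem_regularSubring (hNreg _ _ _ hr₀) (hBreg _ _ _ (hstab hs₁ hout)) b a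
    · intro ω hω
      rw [← hconj ω hω, RCLike.norm_conj]
      exact hnorm ω hω
  choose Q hQ using hconst
  have hQC : N₁ * B₀ = (Matrix.of Q).map RatFunc.C := by
    ext a b
    rw [hQ]
    rfl
  have hB : B₀ = B₁ * (Matrix.of Q).map RatFunc.C := by
    rw [← hQC, ← Matrix.mul_assoc, hBN₁, Matrix.one_mul]
  -- Obtained by solving `A₀ L₀ = A₁ L₁ Q` for `A₀`; the congruence is orthogonality of `Q`.
  refine ⟨L₁ * Matrix.of Q * L₀⁻¹, ?_, ?_⟩
  · calc A₀ = B₀ * L₀⁻¹.map RatFunc.C := by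
          rw [hB₀, Matrix.mul_assoc, hCC L₀ hL₀, Matrix.mul_one]
      _ = A₁ * (L₁ * Matrix.of Q * L₀⁻¹).map RatFunc.C := by
          rw [hB, hB₁, ← map_C_mul, ← map_C_mul]
          simp only [Matrix.mul_assoc]
  · obtain ⟨ω, hω⟩ : D.Nonempty := by
      by_contra hne
      rw [Set.not_nonempty_iff_eq_empty] at hne
      rw [hne, Set.compl_empty] at hD
      exact Set.not_countable_univ hD
    have h1 := (hunit ω hω).1
    rw [hQC, map_C_map_evalAt, conjTranspose_map_real, ← Matrix.map_mul] at h1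
    have hQQ : Matrix.of Q * (Matrix.of Q)ᵀ = 1 := by
      refine Matrix.map_injective (algebraMap ℝ ℂ).injective ?_
      simpa using h1
    rw [Matrix.transpose_mul, Matrix.transpose_mul]
    have h2 : L₀⁻¹ * L₀ = 1 := Matrix.nonsing_inv_mul _ hL₀.isUnit
    have h3 : L₀ᵀ * (L₀⁻¹)ᵀ = 1 := by rw [← Matrix.transpose_mul, h2, Matrix.transpose_one]
    calc L₁ * Matrix.of Q * L₀⁻¹ * (L₀ * L₀ᵀ) * ((L₀⁻¹)ᵀ * ((Matrix.of Q)ᵀ * L₁ᵀ))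
        = L₁ * (Matrix.of Q * (L₀⁻¹ * L₀) * (L₀ᵀ * (L₀⁻¹)ᵀ) * (Matrix.of Q)ᵀ) * L₁ᵀ := by
          simp only [Matrix.mul_assoc]
      _ = L₁ * L₁ᵀ := by
          rw [h2, h3, Matrix.mul_one, Matrix.mul_one, hQQ, Matrix.mul_one]

/-- Two unit lower triangular matrices that agree up to a congruence between nonsingular diagonal
matrices are equal. -/
theorem eq_one_of_triangular_congruence {b : ι → ℕ} (hb : b.Injective) {W₀ W₁ U : Matrix ι ι ℝ}
    {Λ₀ Λ₁ : Matrix ι ι ℝ} (hW₀ : ∀ i j, b i < b j → W₀ i j = 0) (hd₀ : ∀ i, W₀ i i = 1)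
    (hW₁ : ∀ i j, b i < b j → W₁ i j = 0) (hd₁ : ∀ i, W₁ i i = 1)
    (hdet₀ : W₀.det ≠ 0) (hdet₁ : W₁.det ≠ 0) (hU : W₀ = W₁ * U)
    (hΛ₀ : Λ₀.IsDiag) (hΛ₁ : Λ₁.IsDiag) (hdΛ : Λ₀.det ≠ 0) (hcong : U * Λ₀ * Uᵀ = Λ₁) :
    U = 1 := by
  let _ := W₁.invertibleOfIsUnitDet hdet₁.isUnit
  have hT₀ : W₀.BlockTriangular (OrderDual.toDual ∘ b) := fun i j h => hW₀ i j h
  have hT₁ : W₁.BlockTriangular (OrderDual.toDual ∘ b) := fun i j h => hW₁ i j h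
  have hU' : U = W₁⁻¹ * W₀ := by
    rw [hU, ← Matrix.mul_assoc, Matrix.nonsing_inv_mul _ hdet₁.isUnit, Matrix.one_mul]
  have hTU : U.BlockTriangular (OrderDual.toDual ∘ b) := by
    rw [hU']
    exact (Matrix.blockTriangular_inv_of_blockTriangular hT₁).mul hT₀
  have hdetU : U.det ≠ 0 := by
    rw [hU, Matrix.det_mul] at hdet₀
    exact right_ne_zero_of_mul hdet₀
  let _ := U.invertibleOfIsUnitDet hdetU.isUnit
  have hTI := Matrix.blockTriangular_inv_of_blockTriangular hTU
  have hdiag : ∀ i, U i i = 1 := by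
    intro i
    have h1 := hd₀ i
    rw [hU, Matrix.mul_apply, Finset.sum_eq_single i, hd₁, one_mul] at h1
    · exact h1
    · intro k _ hk
      rcases lt_or_gt_of_ne (hb.ne hk) with h | h
      · rw [hTU (i := k) (j := i) h, mul_zero]
      · rw [hW₁ i k h, zero_mul]
    · simp
  have hΛ0 : ∀ i, Λ₀ i i ≠ 0 := by
    intro i h0
    apply hdΛ
    rw [← hΛ₀.diagonal_diag, Matrix.det_diagonal]
    exact Finset.prod_eq_zero (Finset.mem_univ i) h0
  -- The left side is lower triangular and the right side upper triangular in the order given by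
  -- `b`, so `U` is diagonal.
  have hcong' : U * Λ₀ = Λ₁ * (U⁻¹)ᵀ := by
    rw [← hcong, Matrix.mul_assoc (U * Λ₀), ← Matrix.transpose_mul,
      Matrix.nonsing_inv_mul _ hdetU.isUnit, Matrix.transpose_one, Matrix.mul_one]
  ext i j
  by_cases hij : i = j
  · subst hij
    rw [hdiag, Matrix.one_apply_eq]
  rw [Matrix.one_apply_ne hij]
  rcases lt_or_gt_of_ne (hb.ne hij) with h | h
  · exact hTU (i := i) (j := j) h
  · have h1 := congrFun (congrFun hcong' i) j
    rw [← hΛ₀.diagonal_diag, ← hΛ₁.diagonal_diag, Matrix.mul_diagonal, Matrix.diagonal_mul,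
      Matrix.transpose_apply, hTI (i := j) (j := i) h, mul_zero] at h1
    exact (mul_eq_zero.mp h1).resolve_right (hΛ0 j)

end SpectralFactorization

/-! ### Recovering the noise response, and the network equation -/

namespace ParamNetwork

open MeasureTheory

variable {V K : Type*} [Fintype V] [DecidableEq V] {n : ℕ} {M : ParamNetwork V K n}

theorem isProper_one_sub_G (hM : M.IsModelSet) {θ : Fin n → ℝ} (hθ : θ ∈ M.Θ) (i j : V) :
    IsProper ((1 - M.G θ) i j) := by
  refine properSubring.sub_mem ?_ (hM.G_proper θ hθ i j)
  by_cases h : i = j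
  · rw [h, Matrix.one_apply_eq]
    exact one_mem properSubring
  · rw [Matrix.one_apply_ne h]
    exact zero_mem properSubring

theorem map_one_sub_G (hM : M.IsModelSet) {θ : Fin n → ℝ} (hθ : θ ∈ M.Θ) :
    (1 - M.G θ).map valueAtInfty = 1 - M.Ginf θ := by
  ext i j
  let g : properSubring := ⟨M.G θ i j, hM.G_proper θ hθ i j⟩
  by_cases h : i = j
  · simp only [Matrix.map_apply, Matrix.sub_apply, h, Matrix.one_apply_eq, Ginf]
    subst h
    exact (map_sub properValue 1 g).trans (by rw [map_one]; rfl)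
  · simp only [Matrix.map_apply, Matrix.sub_apply, Matrix.one_apply_ne h, Ginf]
    exact (map_sub properValue 0 g).trans (by rw [map_zero]; rfl)

theorem det_one_sub_Ginf_ne_zero (hM : M.IsModelSet) {θ : Fin n → ℝ} (hθ : θ ∈ M.Θ) :
    (1 - M.Ginf θ).det ≠ 0 := by
  have h := hM.wellPosed θ hθ Finset.univ
  rw [← Matrix.det_submatrix_equiv_self (Equiv.subtypeUnivEquiv (p := fun s : V =>
    s ∈ (Finset.univ : Finset V)) Finset.mem_univ)]
  exact h

theorem inverse_one_sub_G (hM : M.IsModelSet) {θ : Fin n → ℝ} (hθ : θ ∈ M.Θ) :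
    (1 - M.G θ).det ≠ 0 ∧ (∀ i j, IsProper (M.T θ i j)) ∧
      (M.T θ).map valueAtInfty = (1 - M.Ginf θ)⁻¹ := by
  have h := proper_inverse (isProper_one_sub_G hM hθ) (by
    rw [map_one_sub_G hM hθ]
    exact det_one_sub_Ginf_ne_zero hM hθ)
  rw [map_one_sub_G hM hθ] at h
  exact h

theorem isProper_Hfull (hM : M.IsModelSet) {θ : Fin n → ℝ} (hθ : θ ∈ M.Θ) (i : V) (k : M.meas) :
    IsProper (M.Hfull θ i k) := by
  by_cases h : i ∈ M.meas
  · simp only [Hfull, Matrix.of_apply, h, dif_pos]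
    exact hM.H_proper θ hθ _ _
  · simp only [Hfull, Matrix.of_apply, h, dif_neg, not_false_eq_true]
    exact zero_mem properSubring

theorem map_Hfull (hM : M.IsModelSet) {θ : Fin n → ℝ} (hθ : θ ∈ M.Θ) :
    (M.Hfull θ).map valueAtInfty =
      Matrix.of fun (i : V) (k : M.meas) => if i = k then (1 : ℝ) else 0 := by
  ext i k
  by_cases h : i ∈ M.meas
  · have h1 := congrFun (congrFun (hM.H_monic θ hθ) ⟨i, h⟩) k
    rw [Matrix.map_apply, Matrix.one_apply] at h1
    simp only [Hfull, Matrix.map_apply, Matrix.of_apply, h, dif_pos, h1, Subtype.ext_iff]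
  · have h1 : i ≠ k := fun h' => h (h' ▸ k.2)
    simp only [Hfull, Matrix.map_apply, Matrix.of_apply, h, dif_neg, not_false_eq_true, h1,
      if_false]
    exact map_zero properValue

theorem isStable_Hfull (hM : M.IsModelSet) {θ : Fin n → ℝ} (hθ : θ ∈ M.Θ) (i : V) (k : M.meas) :
    M.Hfull θ i k ∈ regularSubring {z | 1 ≤ ‖z‖} := by
  by_cases h : i ∈ M.meas
  · simp only [Hfull, Matrix.of_apply, h, dif_pos]
    exact hM.H_stable θ hθ _ _
  · simp only [Hfull, Matrix.of_apply, h, dif_neg, not_false_eq_true]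
    exact zero_mem _

theorem isProper_CTH (hM : M.IsModelSet) {θ : Fin n → ℝ} (hθ : θ ∈ M.Θ) (i j : M.meas) :
    IsProper (M.CTH θ i j) :=
  isProper_mul_apply (inverse_one_sub_G hM hθ).2.1 (isProper_Hfull hM hθ) i j

theorem isStable_CTH (hM : M.IsModelSet) {θ : Fin n → ℝ} (hθ : θ ∈ M.Θ) (i j : M.meas) :
    IsStable (M.CTH θ i j) := by
  have h : M.CTH θ i j ∈ regularSubring {z | 1 ≤ ‖z‖} :=
    mul_apply_mem_regularSubring (hM.T_stable θ hθ) (isStable_Hfull hM hθ) i j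
  exact fun z hz => h z hz

/-- The noise model is monic, so at infinity it only selects the measured columns. -/
theorem map_CTH (hM : M.IsModelSet) {θ : Fin n → ℝ} (hθ : θ ∈ M.Θ) :
    (M.CTH θ).map valueAtInfty =
      (1 - M.Ginf θ)⁻¹.submatrix (fun s : M.meas => (s : V)) (fun s : M.meas => (s : V)) := by
  obtain ⟨-, hp, hv⟩ := inverse_one_sub_G hM hθ
  have h := map_valueAtInfty_mul hp (isProper_Hfull hM hθ)
  rw [hv, map_Hfull hM hθ] at h
  ext i j
  refine (congrFun (congrFun h i) j).trans ?_
  simp [Matrix.mul_apply]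

theorem CPhiC_eq (θ : Fin n → ℝ) (ω : ℝ) :
    M.CPhiC θ ω = (M.CTH θ).map (evalAt (circlePoint ω)) * (M.Λ θ).map (algebraMap ℝ ℂ) *
      ((M.CTH θ).map (evalAt (circlePoint ω)))ᴴ := by
  ext i j
  rfl

/-- One frequency of full rank suffices, since the covariance is a factor of the square matrix
`CPhiC` there. -/
theorem det_Λ_ne_zero (hfull : M.FullRankSpectrum) {θ : Fin n → ℝ}
    (hθ : θ ∈ M.Θ) : (M.Λ θ).det ≠ 0 := by
  obtain ⟨ω, hω⟩ := (hfull θ hθ).exists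
  intro h0
  have h1 : (M.CPhiC θ ω).det = 0 := by
    have h2 : ((M.Λ θ).map (algebraMap ℝ ℂ)).det = 0 := by
      have := RingHom.map_det (algebraMap ℝ ℂ) (M.Λ θ)
      rw [h0, map_zero] at this
      exact this.symm
    rw [CPhiC_eq, Matrix.det_mul, Matrix.det_mul, h2, mul_zero, zero_mul]
  exact det_ne_zero_of_card_le_rank (by rw [hω, Fintype.card_coe]) h1

/-- Well-posedness makes the principal minor of `I - G^∞` on the unmeasured signals nonzero;
Jacobi's criterion transfers this to the measured block of the inverse. -/
theorem det_map_CTH_ne_zero (hM : M.IsModelSet) {θ : Fin n → ℝ} (hθ : θ ∈ M.Θ) :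
    ((M.CTH θ).map valueAtInfty).det ≠ 0 := by
  rw [map_CTH hM hθ]
  exact det_inv_submatrix_ne_zero (det_one_sub_Ginf_ne_zero hM hθ) M.meas
    (hM.wellPosed θ hθ _)

theorem valueAtInfty_eq_zero {g : RatFunc ℝ} (h : IsStrictlyProper g) : valueAtInfty g = 0 :=
  Polynomial.coeff_eq_zero_of_degree_lt
    (by rwa [← Polynomial.degree_eq_natDegree g.denom_ne_zero])

/-- Without algebraic loops `(I - G^∞)⁻¹` is unit lower triangular. -/
theorem inv_one_sub_Ginf_triangular (hM : M.IsModelSet) {θ : Fin n → ℝ} (hθ : θ ∈ M.Θ)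
    {b : V → ℕ} (hb : b.Injective) (hG : ∀ j i, b j < b i → M.Ginf θ j i = 0) :
    (∀ i j, b i < b j → (1 - M.Ginf θ)⁻¹ i j = 0) ∧ ∀ i, (1 - M.Ginf θ)⁻¹ i i = 1 := by
  have hdet := det_one_sub_Ginf_ne_zero hM hθ
  let _ := (1 - M.Ginf θ).invertibleOfIsUnitDet hdet.isUnit
  have hT : (1 - M.Ginf θ).BlockTriangular (OrderDual.toDual ∘ b) := by
    intro i j h
    have h' : b i < b j := h
    rw [Matrix.sub_apply, hG i j h', Matrix.one_apply_ne (by rintro rfl; exact lt_irrefl _ h'),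
      sub_zero]
  have hTI := Matrix.blockTriangular_inv_of_blockTriangular hT
  refine ⟨fun i j h => hTI (i := i) (j := j) h, fun i => ?_⟩
  have h1 := congrFun (congrFun (Matrix.mul_nonsing_inv _ hdet.isUnit) i) i
  rw [Matrix.mul_apply, Finset.sum_eq_single i] at h1
  · have h2 : M.Ginf θ i i = 0 := by
      rw [Ginf, Matrix.map_apply, hM.G_hollow θ hθ]
      exact map_zero properValue
    rw [Matrix.sub_apply, h2, Matrix.one_apply_eq, sub_zero, one_mul] at h1
    exact h1
  · intro k _ hk
    rcases lt_or_gt_of_ne (hb.ne hk) with h | h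
    · rw [hTI (i := k) (j := i) h, mul_zero]
    · rw [hT (i := i) (j := k) h, zero_mul]
  · simp

/-- The noise model is determined by the spectrum of the measured signals. -/
theorem CTH_eq_of_CPhiC_eq (hM : M.IsModelSet) (hfull : M.FullRankSpectrum)
    (hfeed : M.FeedthroughCondition) (hfactor : ∀ θ ∈ M.Θ, IsMinimumPhase (M.CTH θ))
    {θ₀ θ₁ : Fin n → ℝ} (h₀ : θ₀ ∈ M.Θ) (h₁ : θ₁ ∈ M.Θ)
    (h : ∀ ω : ℝ, M.CPhiC θ₀ ω = M.CPhiC θ₁ ω) : M.CTH θ₀ = M.CTH θ₁ := by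
  obtain ⟨U, hU, hcong⟩ := spectralFactor_unique (isStable_CTH hM h₀) (isStable_CTH hM h₁)
    (isProper_CTH hM h₀) (isProper_CTH hM h₁) (hfactor θ₀ h₀) (hfactor θ₁ h₁)
    (det_map_CTH_ne_zero hM h₀) (det_map_CTH_ne_zero hM h₁) (hM.Λ_posSemidef θ₀ h₀)
    (hM.Λ_posSemidef θ₁ h₁) (det_Λ_ne_zero hfull h₀) (det_Λ_ne_zero hfull h₁)
    (fun ω => by rw [← CPhiC_eq, ← CPhiC_eq, h ω])
  have hUC : ∀ i j, IsProper (U.map RatFunc.C i j) := fun i j => isProper_C _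
  have hinf : (M.CTH θ₀).map valueAtInfty = (M.CTH θ₁).map valueAtInfty * U := by
    have h2 := map_valueAtInfty_mul (isProper_CTH hM h₁) hUC
    rw [← hU] at h2
    rw [h2]
    congr 1
    ext i j
    simp [valueAtInfty_C]
  have hd₀ := det_map_CTH_ne_zero hM h₀
  have hd₁ := det_map_CTH_ne_zero hM h₁
  rw [map_CTH hM h₀] at hd₀ hinf
  rw [map_CTH hM h₁] at hd₁ hinf
  -- For strictly proper `G` both factors equal the identity at infinity. Otherwise both are unit
  -- lower triangular there, and `U` carries one nonsingular diagonal covariance to another.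
  have hU1 : U = 1 := by
    rcases hfeed with hstrict | ⟨hdiag, σ, hσ⟩
    · have hG : ∀ θ ∈ M.Θ, M.Ginf θ = 0 := by
        intro θ hθ
        ext i j
        exact valueAtInfty_eq_zero (hstrict θ hθ i j)
      rw [hG θ₀ h₀, hG θ₁ h₁, sub_zero, inv_one, Matrix.submatrix_one _ Subtype.val_injective,
        Matrix.one_mul] at hinf
      exact hinf.symm
    · have hb : Function.Injective fun v : V => (σ v : ℕ) :=
        Fin.val_injective.comp σ.injective
      have htri : ∀ θ ∈ M.Θ, _ := fun θ hθ =>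
        inv_one_sub_Ginf_triangular hM hθ hb (fun j i hji => hσ θ hθ j i hji)
      exact eq_one_of_triangular_congruence (b := fun s : M.meas => (σ s : ℕ))
        (hb.comp Subtype.val_injective) (fun i j hij => (htri θ₀ h₀).1 i j hij)
        (fun i => (htri θ₀ h₀).2 i) (fun i j hij => (htri θ₁ h₁).1 i j hij)
        (fun i => (htri θ₁ h₁).2 i) hd₀ hd₁ hinf (hdiag θ₀ h₀) (hdiag θ₁ h₁)
        (det_Λ_ne_zero hfull h₀) hcong
  rw [hU, hU1]
  simp

/-- Equal measured transfer functions give equal measured rows of `T X`. -/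
theorem TX_eq_of_mem_meas {θ₀ θ₁ : Fin n → ℝ} (hR : M.CTR θ₀ = M.CTR θ₁)
    (hH : M.CTH θ₀ = M.CTH θ₁) {v : V} (hv : v ∈ M.meas) (x : M.Ext) :
    M.TX θ₀ v x = M.TX θ₁ v x := by
  rcases x with p | e
  · exact congrFun (congrFun hR ⟨v, hv⟩) p
  · exact congrFun (congrFun hH ⟨v, hv⟩) e

/-- The network equation `w_j = ∑ G_jk w_k + X_j`. -/
theorem TX_apply (hM : M.IsModelSet) {θ : Fin n → ℝ} (hθ : θ ∈ M.Θ) (j : V) (x : M.Ext) :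
    M.TX θ j x = ∑ k, M.G θ j k * M.TX θ k x + M.X θ j x := by
  have h : (1 - M.G θ) * M.TX θ = M.X θ := by
    rw [TX, T, ← Matrix.mul_assoc,
      Matrix.mul_nonsing_inv _ (inverse_one_sub_G hM hθ).1.isUnit, Matrix.one_mul]
  rw [Matrix.sub_mul, Matrix.one_mul, sub_eq_iff_eq_add] at h
  conv_lhs => rw [h]
  rw [Matrix.add_apply, Matrix.mul_apply, add_comm]

open Classical in
/-- The contribution of the in-neighbors with unknown or unmeasured modules is determined by the
measured transfer functions. -/
theorem sum_inNbr_eq (hM : M.IsModelSet) {θ₀ θ₁ : Fin n → ℝ} (h₀ : θ₀ ∈ M.Θ)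
    (h₁ : θ₁ ∈ M.Θ) {j : V} (hj : j ∈ M.meas)
    (hTX : ∀ v ∈ M.meas, ∀ x, M.TX θ₀ v x = M.TX θ₁ v x) {x : M.Ext}
    (hx : x ∈ M.extNoUnknown j) :
    ∑ k, (if k ∈ M.inNbr j then M.G θ₀ j k * M.TX θ₀ k x else 0) =
      ∑ k, (if k ∈ M.inNbr j then M.G θ₁ j k * M.TX θ₁ k x else 0) := by
  have hX : M.X θ₀ j x = M.X θ₁ j x := hx θ₀ h₀ θ₁ h₁
  -- Outside `inNbr j` a module is fixed to zero, or it is known and its input is measured; either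
  -- way its term is the same in both models.
  have hrest : ∑ k, (if k ∈ M.inNbr j then 0 else M.G θ₀ j k * M.TX θ₀ k x) =
      ∑ k, (if k ∈ M.inNbr j then 0 else M.G θ₁ j k * M.TX θ₁ k x) := by
    refine Finset.sum_congr rfl fun k _ => ?_
    by_cases hk : k ∈ M.inNbr j
    · simp [hk]
    · simp only [hk, if_false]
      have hk' : M.IsFixedZero (Sum.inl k) j ∨ (k ∈ M.meas ∧ M.IsKnown (Sum.inl k) j) := by
        by_contra hcon
        rw [not_or] at hcon
        exact hk hcon
      rcases hk' with hz | ⟨hm, hkn⟩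
      · have z₀ : M.G θ₀ j k = 0 := hz θ₀ h₀
        have z₁ : M.G θ₁ j k = 0 := hz θ₁ h₁
        rw [z₀, z₁, zero_mul, zero_mul]
      · have e : M.G θ₀ j k = M.G θ₁ j k := hkn θ₀ h₀ θ₁ h₁
        rw [e, hTX k hm x]
  have hsplit : ∀ θ, ∑ k, M.G θ j k * M.TX θ k x =
      ∑ k, (if k ∈ M.inNbr j then M.G θ j k * M.TX θ k x else 0) +
      ∑ k, (if k ∈ M.inNbr j then 0 else M.G θ j k * M.TX θ k x) := by
    intro θ
    rw [← Finset.sum_add_distrib]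
    refine Finset.sum_congr rfl fun k _ => ?_
    by_cases hk : k ∈ M.inNbr j <;> simp [hk]
  have e₀ := TX_apply hM h₀ j x
  have e₁ := TX_apply hM h₁ j x
  rw [hsplit] at e₀ e₁
  have e := hTX j hj x
  rw [e₀, e₁, hX, hrest] at e
  exact add_right_cancel (add_right_cancel e)

/-- The linear algebra of the identifiability argument: `w_i` is not in the span of the other
contributions, so that its module is determined. -/
theorem G_eq_of_rowSpan (hM : M.IsModelSet) {θ₀ θ₁ : Fin n → ℝ} (h₀ : θ₀ ∈ M.Θ)
    (h₁ : θ₁ ∈ M.Θ) {i j : V} (hi : i ∈ M.meas) (hj : j ∈ M.meas)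
    (hTX : ∀ v ∈ M.meas, ∀ x, M.TX θ₀ v x = M.TX θ₁ v x) {X : Set M.Ext}
    (hX : X ⊆ M.extNoUnknown j) (S : Submodule (RatFunc ℝ) (X → RatFunc ℝ))
    (hS₀ : ∀ k ∈ M.inNbr j \ {i}, (fun x : X => M.TX θ₀ k x) ∈ S)
    (hS₁ : ∀ k ∈ M.inNbr j \ {i}, (fun x : X => M.TX θ₁ k x) ∈ S)
    (hiN : i ∈ M.inNbr j) (hiS : (fun x : X => M.TX θ₀ i x) ∉ S) :
    M.G θ₀ j i = M.G θ₁ j i := by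
  classical
  let row : (Fin n → ℝ) → V → X → RatFunc ℝ := fun θ k x => M.TX θ k x
  let rest : (Fin n → ℝ) → X → RatFunc ℝ := fun θ =>
    ∑ k ∈ Finset.univ.erase i, if k ∈ M.inNbr j then M.G θ j k • row θ k else 0
  have hrest : ∀ θ, (∀ k ∈ M.inNbr j \ {i}, row θ k ∈ S) → rest θ ∈ S := by
    intro θ hθ
    refine S.sum_mem fun k hk => ?_
    by_cases hkN : k ∈ M.inNbr j
    · simp only [hkN, if_true]
      exact S.smul_mem _ (hθ k ⟨hkN, Finset.ne_of_mem_erase hk⟩)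
    · simp only [hkN, if_false]
      exact S.zero_mem
  have hsum : ∀ θ (x : X), ∑ k, (if k ∈ M.inNbr j then M.G θ j k * M.TX θ k x else 0) =
      (M.G θ j i • row θ i + rest θ) x := by
    intro θ x
    have hrestx : rest θ x = ∑ k ∈ Finset.univ.erase i,
        (if k ∈ M.inNbr j then M.G θ j k • row θ k else 0) x := Finset.sum_apply _ _ _
    rw [← Finset.add_sum_erase _ _ (Finset.mem_univ i), if_pos hiN, Pi.add_apply, hrestx]
    refine congrArg₂ _ rfl (Finset.sum_congr rfl fun k _ => ?_)
    by_cases hkN : k ∈ M.inNbr j <;> simp [hkN, row]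
  have hvec : M.G θ₀ j i • row θ₀ i + rest θ₀ = M.G θ₁ j i • row θ₁ i + rest θ₁ := by
    funext x
    rw [← hsum, ← hsum]
    exact sum_inNbr_eq hM h₀ h₁ hj hTX (hX x.2)
  have hrow : row θ₁ i = row θ₀ i := funext fun x => (hTX i hi x).symm
  rw [hrow] at hvec
  by_contra hne
  apply hiS
  have hdiff : (M.G θ₀ j i - M.G θ₁ j i) • row θ₀ i = rest θ₁ - rest θ₀ := by
    rw [sub_smul, sub_eq_sub_iff_add_eq_add, hvec, add_comm]
  have hmem : (M.G θ₀ j i - M.G θ₁ j i) • row θ₀ i ∈ S := by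
    rw [hdiff]
    exact S.sub_mem (hrest θ₁ hS₁) (hrest θ₀ hS₀)
  exact (S.smul_mem_iff (sub_ne_zero.mpr hne)).mp hmem

end ParamNetwork

end DynNet

end

/-! ### The identifiability criterion -/

theorem mainTheorem8 {V K : Type*} [Fintype V] [DecidableEq V] [Fintype K] {n : ℕ}
    (M : DynNet.ParamNetwork V K n) (hM : M.IsModelSet)
    (hfull : M.FullRankSpectrum) (hind : M.IndependentlyParameterized)
    (hfeed : M.FeedthroughCondition) (hfix : M.FixedEntriesRegular)
    (hfactor : ∀ θ ∈ M.Θ, DynNet.IsMinimumPhase (M.CTH θ))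
    (i j : V) (hi : i ∈ M.meas) (hj : j ∈ M.meas)
    (Xbar : Set M.Ext) (hX : Xbar ⊆ M.extNoUnknown j)
    (Cbar : Set V) (hC : Cbar ⊆ (M.meas : Set V) \ {i})
    (h1 : M.b (Sum.inr '' Xbar) (Sum.inl '' (M.inNbr j ∪ Cbar)) =
      M.b (Sum.inr '' Xbar) (Sum.inl '' ((M.inNbr j \ {i}) ∪ Cbar)) + 1)
    (h2 : M.b (Sum.inr '' Xbar) (Sum.inl '' ((M.inNbr j \ {i}) ∪ Cbar)) =
      M.b (Sum.inr '' Xbar) (Sum.inl '' Cbar)) :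
    M.GenericallyIdentifiable j i := by
  have hdet : ∀ θ ∈ M.Θ, (1 - M.G θ).det ≠ 0 := fun θ hθ =>
    (DynNet.ParamNetwork.inverse_one_sub_G hM hθ).1
  -- Otherwise removing `i` changes nothing and `h1` reads `b = b + 1`.
  have hiN : i ∈ M.inNbr j := by
    by_contra h
    rw [Set.sdiff_singleton_eq_self h] at h1
    omega
  -- Genericity is imposed on `θ₀` alone; nothing generic may be assumed of `θ₁`.
  filter_upwards [DynNet.ParamNetwork.ae_b_le_finrank_rowSpan hM hdet hind hfix
      (M.inNbr j ∪ Cbar) Xbar,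
    DynNet.ParamNetwork.ae_b_le_finrank_rowSpan hM hdet hind hfix Cbar Xbar]
    with θ₀ hgen₁ hgen₂ h₀ θ₁ h₁ hR hΦ
  have hH := DynNet.ParamNetwork.CTH_eq_of_CPhiC_eq hM hfull hfeed hfactor h₀ h₁ hΦ
  have hTX : ∀ v ∈ M.meas, ∀ x, M.TX θ₀ v x = M.TX θ₁ v x := fun v hv x =>
    DynNet.ParamNetwork.TX_eq_of_mem_meas hR hH hv x
  have hcommon : DynNet.rowSpan (M.TX θ₀) Cbar Xbar = DynNet.rowSpan (M.TX θ₁) Cbar Xbar :=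
    congrArg (Submodule.span (RatFunc ℝ)) (Set.image_congr fun v hv =>
      funext fun x => hTX v (hC hv).1 x)
  -- A squeeze of ranks: the larger family has rank at most its path number, which by `h2` is that
  -- of `Cbar` and so at most the rank of the rows in `Cbar` at the generic `θ₀`. Hence adding the
  -- rows of `inNbr j \ {i}` does not enlarge the span.
  have hspan : ∀ θ ∈ M.Θ, DynNet.rowSpan (M.TX θ₀) Cbar Xbar = DynNet.rowSpan (M.TX θ) Cbar Xbar →
      DynNet.rowSpan (M.TX θ) ((M.inNbr j \ {i}) ∪ Cbar) Xbar =
        DynNet.rowSpan (M.TX θ₀) Cbar Xbar := by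
    intro θ hθ heq
    rw [heq]
    refine (Submodule.eq_of_le_of_finrank_le
      (DynNet.rowSpan_mono _ Set.subset_union_right _) ?_).symm
    rw [← heq]
    exact (DynNet.ParamNetwork.finrank_rowSpan_le_b hθ (hdet θ hθ) _ _).trans
      (h2.le.trans (hgen₂ h₀))
  have hspan₀ := hspan θ₀ h₀ rfl
  have hspan₁ := hspan θ₁ h₁ hcommon
  refine DynNet.ParamNetwork.G_eq_of_rowSpan hM h₀ h₁ hi hj hTX hX
    (DynNet.rowSpan (M.TX θ₀) Cbar Xbar) (fun k hk => ?_) (fun k hk => ?_) hiN fun hmem => ?_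
  · rw [← hspan₀]
    exact DynNet.mem_rowSpan _ _ (Or.inl hk)
  · rw [← hspan₁]
    exact DynNet.mem_rowSpan _ _ (Or.inl hk)
  -- If row `i` were in the span too, the rank over `inNbr j ∪ Cbar` would not exceed the path
  -- number without `i`, whereas generically it is at least one more by `h1`.
  · have hle : DynNet.rowSpan (M.TX θ₀) (M.inNbr j ∪ Cbar) Xbar ≤
        DynNet.rowSpan (M.TX θ₀) ((M.inNbr j \ {i}) ∪ Cbar) Xbar := by
      refine Submodule.span_le.mpr ?_
      rintro _ ⟨v, hv, rfl⟩
      by_cases hvi : v = i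
      · rw [hspan₀, hvi]
        exact hmem
      · exact DynNet.mem_rowSpan _ _ (hv.imp (fun h => ⟨h, hvi⟩) id)
    have hfin := (Submodule.finrank_mono hle).trans
      (DynNet.ParamNetwork.finrank_rowSpan_le_b h₀ (hdet θ₀ h₀) _ _)
    have hlow := hgen₁ h₀
    omega
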